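/- Let $(X,e),(X_1,e_1),(X_2,e_2),\dots$ be i.i.d. pairs of real random variables and $Y_i=g(X_i)+e_i$, with $g$ Borel measurable. Fix $\alpha\in[0,\tfrac12)$ and $x_0\in\mathbb R$. Let $X_{(1)}\le\dots\le X_{(n)}$ be the order statistics of $X_1,\dots,X_n$, and let $Y_{[i]}$ be the response belonging to $X_{(i)}$. For a kernel $K$ and bandwidths $h_n$, the trimmed Nadaraya–Watson estimator is $$\hat g_{n,\alpha}(x_0)=\frac{\sum_{i=[n\alpha]+1}^{n-[n\alpha]}k_n(X_{(i)}-x_0)\,Y_{[i]}}{\sum_{i=[n\alpha]+1}^{n-[n\alpha]}k_n(X_{(i)}-x_0)},\qquad k_n(u)=\frac1{h_n}K\Big(\frac u{h_n}\Big)$$ (with the value $0$, say, if the denominator vanishes). Assume: (A1) $g$ is twice continuously differentiable on a compact set that contains $x_0$ in its interior. (A2) $X$ has a bounded density $f_X$, and $f_X$ is differentiable at $x_0$. (A3) $K$ is a bounded probability density vanishing outside $(-\tau,\tau)$, with $\tau<\infty$, $\int uK(u)\,du=0$ and $h_n^{-1}K(h_n^{-1})=O(1)$. (A4) $h_n>0$,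 $h_n=O(n^{-1/3})$ and $nh_n\to\infty$. (A5) $e$ has a density symmetric about $0$, $E(e\mid X)=0$, and $E(e^2\mid X=x)=\sigma^2(x)<\infty$ with $\sigma^2$ continuous at $x_0$. (A6) For some $\delta>0$, $E|e|^{2+\delta}<\infty$, and $E(|e|^{2+\delta}\mid X=x)$ is bounded (for almost every $x$) in a neighbourhood of $x_0$. Let $F_X$ be the distribution function of $X$ and suppose that $f_X(x_0)>0$ and $\alpha<F_X(x_0)<1-\alpha$. Let $$f_{X_{(i)}}(x)=\frac{n!}{(i-1)!\,(n-i)!}F_X(x)^{i-1}(1-F_X(x))^{n-i}f_X(x)$$ be the density of $X_{(i)}$. Then the limit $$t_\alpha(x_0)=\lim_{n\to\infty}\frac1{n-2[n\alpha]}\sum_{i=[n\alpha]+1}^{n-[n\alpha]}f_{X_{(i)}}(x_0)$$ exists and is positive, and, as $n\to\infty$, $$\sqrt{nh_n}\left(\hat g_{n,\alpha}(x_0)-g(x_0)-h_n^2k_2\left(\frac{g''(x_0)}{2(n-2[n\alpha])}\sum_{i=[n\alpha]+1}^{n-[n\alpha]}f_{X_{(i)}}(x_0)+\frac{g'(x_0)}{n-2[n\alpha]}\sum_{i=[n\alpha]+1}^{n-[n\alpha]}f'_{X_{(i)}}(x_0)\right)\right)$$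 converges weakly to $N(0,V)$, where $$k_2=\int v^2K(v)\,dv,\qquad V=\frac{\sigma^2(x_0)\int K(u)^2\,du}{(1-2\alpha)\,t_\alpha(x_0)}.$$ -/

import Mathlib

open MeasureTheory ProbabilityTheory Filter Topology Asymptotics

noncomputable section

namespace TrimmedNW

/-- The ranks kept after trimming. The index `i : Fin n` stands for rank `i + 1`, so these are the
ranks `[n α] + 1, …, n - [n α]`. -/
def untrimmed (n : ℕ) (α : ℝ) : Finset (Fin n) :=
  Finset.univ.filter fun i => ⌊(n : ℝ) * α⌋₊ ≤ (i : ℕ) ∧ (i : ℕ) < n - ⌊(n : ℝ) * α⌋₊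

/-- The number `n - 2 [n α]` of ranks kept, as a real number. -/
def keptCount (n : ℕ) (α : ℝ) : ℝ := (n : ℝ) - 2 * (⌊(n : ℝ) * α⌋₊ : ℝ)

/-- The order statistic of rank `i + 1` of the sample `x`. -/
def orderStat {n : ℕ} (x : Fin n → ℝ) (i : Fin n) : ℝ := x (Tuple.sort x i)

/-- The concomitant: the entry of `y` that belongs to the order statistic of rank `i + 1`
of `x`. -/
def concomitant {n : ℕ} (x y : Fin n → ℝ) (i : Fin n) : ℝ := y (Tuple.sort x i)

/-- The rescaled kernel `K(u / h) / h`. -/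
def scaledKernel (K : ℝ → ℝ) (h u : ℝ) : ℝ := h⁻¹ * K (u / h)

/-- The `α`-trimmed Nadaraya-Watson estimator at `x₀` computed from `(x i, y i)`, `i < n`. -/
def estimator (K : ℝ → ℝ) (h α x₀ : ℝ) {n : ℕ} (x y : Fin n → ℝ) : ℝ :=
  (∑ i ∈ untrimmed n α, scaledKernel K h (orderStat x i - x₀) * concomitant x y i) /
    ∑ i ∈ untrimmed n α, scaledKernel K h (orderStat x i - x₀)

/-- The density of the order statistic of rank `r` (`1 ≤ r ≤ n`) of `n` independent observations
whose common law `P` has density `f`: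
`n! / ((r - 1)! (n - r)!) * F(x)^(r - 1) * (1 - F(x))^(n - r) * f(x)`, with `F` the distribution
function of `P`. -/
def orderStatDensity (P : Measure ℝ) (f : ℝ → ℝ) (n r : ℕ) (x : ℝ) : ℝ :=
  (n.factorial : ℝ) / ((r - 1).factorial * (n - r).factorial : ℝ) *
    cdf P x ^ (r - 1) * (1 - cdf P x) ^ (n - r) * f x

/-- The average of the densities at `x` of the order statistics of the ranks kept. -/
def avgDensity (P : Measure ℝ) (f : ℝ → ℝ) (α : ℝ) (n : ℕ) (x : ℝ) : ℝ :=
  (keptCount n α)⁻¹ * ∑ i ∈ untrimmed n α, orderStatDensity P f n ((i : ℕ) + 1) x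

/-- The average of the derivatives at `x` of the densities of the order statistics of the ranks
kept. -/
def avgDensityDeriv (P : Measure ℝ) (f : ℝ → ℝ) (α : ℝ) (n : ℕ) (x : ℝ) : ℝ :=
  (keptCount n α)⁻¹ * ∑ i ∈ untrimmed n α, deriv (orderStatDensity P f n ((i : ℕ) + 1)) x

/-- The bias term `h² k₂ (g''(x₀) / 2 * avg f_(i)(x₀) + g'(x₀) * avg f_(i)'(x₀))`, with
`k₂ = ∫ v² K(v) dv`. -/
def biasTerm (P : Measure ℝ) (f g K : ℝ → ℝ) (h α : ℝ) (n : ℕ) (x₀ : ℝ) : ℝ :=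
  h ^ 2 * (∫ v, v ^ 2 * K v) *
    (deriv (deriv g) x₀ / 2 * avgDensity P f α n x₀ + deriv g x₀ * avgDensityDeriv P f α n x₀)

/-- The asymptotic variance `s ∫ K² / ((1 - 2 α) t)`. -/
def asymptoticVariance (K : ℝ → ℝ) (α s t : ℝ) : ℝ :=
  s * (∫ u, K u ^ 2) / ((1 - 2 * α) * t)

end TrimmedNW

end

/-!
The proof rests on two reductions.

*Trimming is invisible.* Since `α < F(x₀) < 1 - α`, by the weak law of large numbers more than
`n α` observations lie below a fixed small window around `x₀`, and more than `n α` above it, with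
probability tending to one. Once the support of the kernel has shrunk into this window, every
observation with a nonzero weight survives the trimming, and the estimator is the ordinary
Nadaraya-Watson ratio (`estimator_eq_of_card`).

*The bias is negligible.* As `h = O(n ^ (-1/3))`, the factor `√(n h) h ^ 2` tends to zero
(`tendsto_sqrt_mul_sq`). This removes the bias term of the statement as soon as the averages of
the densities and of their derivatives stay bounded. Up to the factor `n f(x₀) / (n - 2 [n α])`
the average density is the probability that a binomial variable with parameters `n - 1` and
`F(x₀)` falls into the kept ranks. Chebyshev's inequality gives the limit
`t = f(x₀) / (1 - 2 α)` (`tendsto_avgDensity`), and a weighted form of it bounds the derivative of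
that probability (`avgDensityDeriv_isBigO`).

What remains is the ratio `(S + A) / D`, where, with the weights `w_i = K((X_i - x₀) / h)`,
`S = ∑ w_i e_i / √(n h)`, `A = ∑ w_i (g(X_i) - g(x₀)) / √(n h)` and `D = ∑ w_i / (n h)`.
Second moments give `D → f(x₀)` and `A → 0` in probability (`tendstoInMeasure_denominator`,
`tendstoInMeasure_bias`). For the mean of `A`, the linear terms cancel because the kernel is
centered. Lyapunov's central limit theorem for triangular arrays (`tendstoInDistribution_rowSum`),
proved with characteristic functions, gives `S → N(0, σ²(x₀) f(x₀) ∫ K²)`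
(`tendstoInDistribution_noise`), and Slutsky's theorem concludes.
-/

namespace TrimmedNW

/-! ### Order statistics and trimming -/

/-- The observations that are at most `a` all have a rank below that of an order statistic that
exceeds `a`. -/
lemma card_le_rank {n : ℕ} (x : Fin n → ℝ) (a : ℝ) (i : Fin n) (hi : a < orderStat x i) :
    (Finset.univ.filter fun k => x k ≤ a).card ≤ (i : ℕ) := by
  rw [← Fin.card_Iio i, ← Finset.card_map (s := Finset.Iio i) (Tuple.sort x).toEmbedding]
  refine Finset.card_le_card fun k hk => ?_
  rw [Finset.mem_filter] at hk
  refine Finset.mem_map.2 ⟨(Tuple.sort x).symm k, Finset.mem_Iio.2 ?_, by simp⟩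
  by_contra! hlt
  have h1 := Tuple.monotone_sort x hlt
  simp only [Function.comp_apply, Equiv.apply_symm_apply] at h1
  exact absurd (hi.trans_le h1) (not_lt.2 hk.2)

lemma card_lt_sub_rank {n : ℕ} (x : Fin n → ℝ) (b : ℝ) (i : Fin n) (hi : orderStat x i ≤ b) :
    (Finset.univ.filter fun k => b < x k).card + (i : ℕ) < n := by
  have h : (Finset.univ.filter fun k => b < x k).card ≤ n - 1 - i := by
    rw [← Fin.card_Ioi i, ← Finset.card_map (s := Finset.Ioi i) (Tuple.sort x).toEmbedding]
    refine Finset.card_le_card fun k hk => ?_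
    rw [Finset.mem_filter] at hk
    refine Finset.mem_map.2 ⟨(Tuple.sort x).symm k, Finset.mem_Ioi.2 ?_, by simp⟩
    by_contra! hlt
    have h1 := Tuple.monotone_sort x hlt
    simp only [Function.comp_apply, Equiv.apply_symm_apply] at h1
    exact absurd (hk.2.trans_le h1) (not_lt.2 hi)
  omega

/-- When at least `[n α]` observations lie on either side of the window on which the kernel is
nonzero, every observation in the window survives the trimming, and the estimator is the ordinary
Nadaraya-Watson ratio. -/
lemma estimator_eq_of_card {n : ℕ} (K : ℝ → ℝ) (h α x₀ a b : ℝ) (x y : Fin n → ℝ)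
    (hK : ∀ u, K ((u - x₀) / h) ≠ 0 → a < u ∧ u ≤ b)
    (ha : ⌊(n : ℝ) * α⌋₊ ≤ (Finset.univ.filter fun k => x k ≤ a).card)
    (hb : ⌊(n : ℝ) * α⌋₊ ≤ (Finset.univ.filter fun k => b < x k).card) :
    estimator K h α x₀ x y =
      (∑ i, scaledKernel K h (x i - x₀) * y i) / ∑ i, scaledKernel K h (x i - x₀) := by
  have hz : ∀ i ∉ untrimmed n α, scaledKernel K h (orderStat x i - x₀) = 0 := by
    intro i hi
    by_contra hne
    obtain ⟨h1, h2⟩ := hK (orderStat x i) fun h0 => hne (by simp [scaledKernel, h0])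
    have h3 := card_le_rank x a i h1
    have h4 := card_lt_sub_rank x b i h2
    refine hi (Finset.mem_filter.2 ⟨Finset.mem_univ _, ?_, ?_⟩) <;> omega
  unfold estimator
  rw [Finset.sum_subset (Finset.subset_univ _) (fun i _ hi => by rw [hz i hi, zero_mul]),
    Finset.sum_subset (Finset.subset_univ _) (fun i _ hi => hz i hi)]
  congr 1
  · exact Equiv.sum_comp (Tuple.sort x) fun i => scaledKernel K h (x i - x₀) * y i
  · exact Equiv.sum_comp (Tuple.sort x) fun i => scaledKernel K h (x i - x₀)

/-- The sorting permutation depends measurably on the sample: it equals `σ` exactly when finitely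
many inequalities and equalities between coordinates hold, with ties broken by the index. -/
lemma measurable_sort_apply {n : ℕ} (i : Fin n) :
    Measurable fun x : Fin n → ℝ => Tuple.sort x i := by
  refine measurable_to_countable' fun j => ?_
  have : (fun x : Fin n → ℝ => Tuple.sort x i) ⁻¹' {j} =
      ⋃ σ ∈ {σ : Equiv.Perm (Fin n) | σ i = j}, {x : Fin n → ℝ |
        (∀ k l, k ≤ l → x (σ k) ≤ x (σ l)) ∧ ∀ k l, k < l → x (σ k) = x (σ l) → σ k < σ l} := by
    ext x
    have hs (σ : Equiv.Perm (Fin n)) := @Tuple.eq_sort_iff n ℝ _ x σ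
    simp only [Set.mem_preimage, Set.mem_singleton_iff, Set.mem_iUnion, Set.mem_ofPred_eq,
      exists_prop]
    constructor
    · exact fun h => ⟨Tuple.sort x, h, ((hs _).1 rfl).1, ((hs _).1 rfl).2⟩
    · rintro ⟨σ, h1, h2, h3⟩
      rw [← (hs σ).2 ⟨h2, h3⟩, h1]
  rw [this]
  refine MeasurableSet.biUnion (Set.to_countable _) fun σ _ => ?_
  refine MeasurableSet.inter ?_ ?_
  · have : {x : Fin n → ℝ | ∀ k l, k ≤ l → x (σ k) ≤ x (σ l)} =
        ⋂ k, ⋂ l, ⋂ (_ : k ≤ l), {x : Fin n → ℝ | x (σ k) ≤ x (σ l)} := by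
      ext x
      simp only [Set.mem_ofPred_eq, Set.mem_iInter]
    change MeasurableSet {x : Fin n → ℝ | ∀ k l, k ≤ l → x (σ k) ≤ x (σ l)}
    rw [this]
    refine MeasurableSet.iInter fun k => .iInter fun l => .iInter fun _ => ?_
    exact measurableSet_le (by fun_prop) (by fun_prop)
  · have : {x : Fin n → ℝ | ∀ k l, k < l → x (σ k) = x (σ l) → σ k < σ l} =
        ⋂ k, ⋂ l, ⋂ (_ : k < l ∧ ¬ σ k < σ l), {x : Fin n → ℝ | x (σ k) = x (σ l)}ᶜ := by
      ext x
      simp only [Set.mem_ofPred_eq, Set.mem_iInter, Set.mem_compl_iff]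
      grind
    change MeasurableSet {x : Fin n → ℝ | ∀ k l, k < l → x (σ k) = x (σ l) → σ k < σ l}
    rw [this]
    refine MeasurableSet.iInter fun k => .iInter fun l => .iInter fun _ => .compl ?_
    exact measurableSet_eq_fun (by fun_prop) (by fun_prop)

lemma measurable_apply_sort {n : ℕ} {Ω : Type*} [MeasurableSpace Ω] {X Y : Fin n → Ω → ℝ}
    (hX : ∀ i, Measurable (X i)) (hY : ∀ i, Measurable (Y i)) (i : Fin n) :
    Measurable fun ω => Y (Tuple.sort (fun j => X j ω) i) ω := by
  have h1 : Measurable fun p : Fin n × Ω => Y p.1 p.2 :=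
    measurable_from_prod_countable_right fun j => hY j
  have h2 : Measurable fun ω => fun j => X j ω := measurable_pi_lambda _ hX
  exact h1.comp (((measurable_sort_apply i).comp h2).prodMk measurable_id)

lemma measurable_estimator {n : ℕ} {Ω : Type*} [MeasurableSpace Ω] {X Y : Fin n → Ω → ℝ}
    (hX : ∀ i, Measurable (X i)) (hY : ∀ i, Measurable (Y i)) {K : ℝ → ℝ} (hK : Measurable K)
    (h α x₀ : ℝ) :
    Measurable fun ω => estimator K h α x₀ (fun i => X i ω) (fun i => Y i ω) := by
  unfold estimator scaledKernel orderStat concomitant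
  have h1 := measurable_apply_sort hX hX
  have h2 := measurable_apply_sort hX hY
  have h3 (i : Fin n) : Measurable fun ω =>
      h⁻¹ * K ((X (Tuple.sort (fun j => X j ω) i) ω - x₀) / h) :=
    (hK.comp (((h1 i).sub_const x₀).div_const h)).const_mul h⁻¹
  exact (Finset.measurable_fun_sum _ fun i _ => (h3 i).mul (h2 i)).div
    (Finset.measurable_fun_sum _ fun i _ => h3 i)

/-! ### Averages of the densities of the order statistics -/

/-- The probability that a binomial variable with parameters `N` and `p` equals `i`. -/
def binomialWeight (N i : ℕ) (p : ℝ) : ℝ := N.choose i * p ^ i * (1 - p) ^ (N - i)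

lemma binomialWeight_nonneg {p : ℝ} (N i : ℕ) (h0 : 0 ≤ p) (h1 : p ≤ 1) :
    0 ≤ binomialWeight N i p := by
  have : 0 ≤ 1 - p := by linarith
  unfold binomialWeight
  positivity

lemma eval_bernsteinPolynomial (N i : ℕ) (p : ℝ) :
    (bernsteinPolynomial ℝ N i).eval p = binomialWeight N i p := by
  simp [bernsteinPolynomial, binomialWeight]

lemma sum_binomialWeight (N : ℕ) (p : ℝ) : ∑ i : Fin (N + 1), binomialWeight N i p = 1 := by
  have := congrArg (Polynomial.eval p) (bernsteinPolynomial.sum ℝ N)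
  simpa [Polynomial.eval_finsetSum, eval_bernsteinPolynomial, Finset.sum_range] using this

lemma sum_mul_binomialWeight (N : ℕ) (p : ℝ) :
    ∑ i : Fin (N + 1), binomialWeight N i p * ((i : ℕ) - N * p) = 0 := by
  have h := congrArg (Polynomial.eval p) (bernsteinPolynomial.sum_smul ℝ N)
  simp only [Polynomial.eval_finsetSum, eval_bernsteinPolynomial,
    Finset.sum_range, nsmul_eq_mul, Polynomial.eval_mul, Polynomial.eval_natCast,
    Polynomial.eval_X] at h
  simp only [mul_sub, Finset.sum_sub_distrib, ← Finset.sum_mul, sum_binomialWeight]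
  rw [← h]
  simp only [mul_comm, one_mul]
  simp

lemma sum_sq_mul_binomialWeight (N : ℕ) (p : ℝ) :
    ∑ i : Fin (N + 1), binomialWeight N i p * ((i : ℕ) - N * p) ^ 2 = N * p * (1 - p) := by
  have h := congrArg (Polynomial.eval p) (bernsteinPolynomial.variance ℝ N)
  simp only [Polynomial.eval_finsetSum, eval_bernsteinPolynomial,
    Finset.sum_range, nsmul_eq_mul, Polynomial.eval_mul, Polynomial.eval_natCast,
    Polynomial.eval_X, Polynomial.eval_pow, Polynomial.eval_sub, Polynomial.eval_one] at h
  rw [← h]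
  exact Finset.sum_congr rfl fun i _ => by ring

lemma hasDerivAt_binomialWeight {N i : ℕ} (hi : i ≤ N) {p : ℝ} (h0 : 0 < p) (h1 : p < 1) :
    HasDerivAt (binomialWeight N i) (binomialWeight N i p * (i - N * p) / (p * (1 - p))) p := by
  have hq : 0 < 1 - p := by linarith
  have h := (((hasDerivAt_id p).pow i).const_mul (N.choose i : ℝ)).mul
    (((hasDerivAt_id p).const_sub 1).pow (N - i))
  refine h.congr_deriv ?_
  obtain ⟨j, rfl⟩ := Nat.exists_eq_add_of_le hi
  simp only [binomialWeight, Nat.add_sub_cancel_left, Pi.pow_apply, id]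
  rw [eq_div_iff (by positivity)]
  rcases i with _ | i <;> rcases j with _ | j <;> simp <;> ring

/-- Ranks that are trimmed away lie at a distance of order `N` from the mean of the binomial
distribution. -/
lemma abs_sub_ge_of_notMem_untrimmed {N : ℕ} {α p c : ℝ} (hα0 : 0 ≤ α) (hα : α < 1 / 2)
    (hl : α + c ≤ p) (hr : p + c ≤ 1 - α) {i : Fin (N + 1)} (hi : i ∉ untrimmed (N + 1) α) :
    c * N ≤ |((i : ℕ) : ℝ) - N * p| := by
  have hN : (0 : ℝ) ≤ N := Nat.cast_nonneg N
  have hm : (⌊((N + 1 : ℕ) : ℝ) * α⌋₊ : ℝ) ≤ (N + 1) * α := by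
    simpa using Nat.floor_le (by positivity : 0 ≤ ((N + 1 : ℕ) : ℝ) * α)
  simp only [untrimmed, Finset.mem_filter, Finset.mem_univ, true_and, not_and_or, not_le,
    not_lt] at hi
  rcases hi with hi | hi
  · have h1 : ((i : ℕ) : ℝ) + 1 ≤ (⌊((N + 1 : ℕ) : ℝ) * α⌋₊ : ℝ) := by exact_mod_cast hi
    rw [abs_sub_comm]
    refine le_trans ?_ (le_abs_self _)
    nlinarith [mul_le_mul_of_nonneg_left hl hN]
  · have h1 : ((N : ℝ) + 1) ≤ (i : ℕ) + (⌊((N + 1 : ℕ) : ℝ) * α⌋₊ : ℝ) := by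
      exact_mod_cast Nat.sub_le_iff_le_add.1 hi
    refine le_trans ?_ (le_abs_self _)
    nlinarith [mul_le_mul_of_nonneg_left hr hN]

section KeptRanks

variable {α p : ℝ}

/-- Chebyshev's inequality: the binomial weight of the trimmed ranks is of order `1 / N`. -/
lemma sum_compl_untrimmed_le {N : ℕ} {c : ℝ} (hα0 : 0 ≤ α) (hα : α < 1 / 2) (hc : 0 < c)
    (hN : 0 < N) (hl : α + c ≤ p) (hr : p + c ≤ 1 - α) :
    ∑ i ∈ (untrimmed (N + 1) α)ᶜ, binomialWeight N i p ≤ (c ^ 2)⁻¹ * (N : ℝ)⁻¹ := by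
  have hN' : (0 : ℝ) < N := Nat.cast_pos.2 hN
  have hw (i : ℕ) : 0 ≤ binomialWeight N i p :=
    binomialWeight_nonneg N i (by linarith) (by linarith)
  have h : ∑ i ∈ (untrimmed (N + 1) α)ᶜ, binomialWeight N i p * (c * N) ^ 2 ≤ N := by
    calc _ ≤ ∑ i ∈ (untrimmed (N + 1) α)ᶜ, binomialWeight N i p * ((i : ℕ) - N * p) ^ 2 := by
          refine Finset.sum_le_sum fun i hi => mul_le_mul_of_nonneg_left ?_ (hw i)
          rw [← sq_abs (((i : ℕ) : ℝ) - N * p)]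
          gcongr
          exact abs_sub_ge_of_notMem_untrimmed hα0 hα hl hr (Finset.mem_compl.1 hi)
      _ ≤ ∑ i : Fin (N + 1), binomialWeight N i p * ((i : ℕ) - N * p) ^ 2 :=
          Finset.sum_le_sum_of_subset_of_nonneg (Finset.subset_univ _)
            fun i _ _ => mul_nonneg (hw i) (sq_nonneg _)
      _ = N * (p * (1 - p)) := by rw [sum_sq_mul_binomialWeight]; ring
      _ ≤ N * 1 := by
          gcongr
          nlinarith
      _ = N := mul_one _
  rw [← Finset.sum_mul] at h
  rw [← mul_inv, ← one_div, le_div_iff₀ (by positivity)]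
  refine le_of_mul_le_mul_right ?_ hN'
  calc _ = (∑ i ∈ (untrimmed (N + 1) α)ᶜ, binomialWeight N i p) * (c * N) ^ 2 := by ring
    _ ≤ 1 * N := by rwa [one_mul]

lemma tendsto_sum_untrimmed (hα0 : 0 ≤ α) (hα : α < 1 / 2) (hl : α < p) (hr : p < 1 - α) :
    Tendsto (fun N : ℕ => ∑ i ∈ untrimmed (N + 1) α, binomialWeight N i p) atTop (𝓝 1) := by
  obtain ⟨c, hc, hc1, hc2⟩ : ∃ c, 0 < c ∧ α + c ≤ p ∧ p + c ≤ 1 - α :=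
    ⟨min (p - α) (1 - α - p), lt_min (by linarith) (by linarith),
      by linarith [min_le_left (p - α) (1 - α - p)],
      by linarith [min_le_right (p - α) (1 - α - p)]⟩
  have h0 : Tendsto (fun N : ℕ => 1 - (c ^ 2)⁻¹ * (N : ℝ)⁻¹) atTop (𝓝 1) := by
    have := (tendsto_inv_atTop_nhds_zero_nat (𝕜 := ℝ)).const_mul (c ^ 2)⁻¹
    simpa using this.const_sub 1
  have hs (N : ℕ) := Finset.sum_add_sum_compl (untrimmed (N + 1) α)
    fun i => binomialWeight N i p
  simp only [sum_binomialWeight] at hs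
  refine tendsto_of_tendsto_of_tendsto_of_le_of_le' h0 tendsto_const_nhds ?_ ?_
  · filter_upwards [eventually_gt_atTop 0] with N hN
    linarith [hs N, sum_compl_untrimmed_le hα0 hα hc hN hc1 hc2]
  · refine .of_forall fun N => ?_
    linarith [hs N, Finset.sum_nonneg fun i (_ : i ∈ (untrimmed (N + 1) α)ᶜ) =>
      binomialWeight_nonneg N i (by linarith : 0 ≤ p) (by linarith)]

/-- The derivative in `p` of the binomial weight of the kept ranks stays bounded. The terms of all
ranks add up to zero, and on the trimmed ranks `|i - N p|` is at most `(i - N p) ^ 2 / (c N)`. -/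
lemma abs_sum_untrimmed_le {N : ℕ} {c : ℝ} (hα0 : 0 ≤ α) (hα : α < 1 / 2) (hc : 0 < c)
    (hN : 0 < N) (hl : α + c ≤ p) (hr : p + c ≤ 1 - α) :
    |∑ i ∈ untrimmed (N + 1) α, binomialWeight N i p * ((i : ℕ) - N * p) / (p * (1 - p))|
      ≤ c⁻¹ := by
  have hN' : (0 : ℝ) < N := Nat.cast_pos.2 hN
  have hp : 0 < p * (1 - p) := mul_pos (by linarith) (by linarith)
  have hw (i : ℕ) : 0 ≤ binomialWeight N i p :=
    binomialWeight_nonneg N i (by linarith) (by linarith)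
  have hs := Finset.sum_add_sum_compl (untrimmed (N + 1) α)
    fun i => binomialWeight N i p * ((i : ℕ) - N * p)
  rw [sum_mul_binomialWeight] at hs
  rw [← Finset.sum_div, eq_neg_of_add_eq_zero_left hs, abs_div, abs_neg, abs_of_pos hp,
    div_le_iff₀ hp]
  calc _ ≤ ∑ i ∈ (untrimmed (N + 1) α)ᶜ, |binomialWeight N i p * ((i : ℕ) - N * p)| :=
        Finset.abs_sum_le_sum_abs _ _
    _ ≤ ∑ i ∈ (untrimmed (N + 1) α)ᶜ,
          binomialWeight N i p * ((i : ℕ) - N * p) ^ 2 * (c * N)⁻¹ := by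
        refine Finset.sum_le_sum fun i hi => ?_
        have h := abs_sub_ge_of_notMem_untrimmed hα0 hα hl hr (Finset.mem_compl.1 hi)
        rw [abs_mul, abs_of_nonneg (hw i), mul_assoc]
        refine mul_le_mul_of_nonneg_left ?_ (hw i)
        rw [← sq_abs, ← div_eq_mul_inv, le_div_iff₀ (by positivity), sq]
        exact mul_le_mul_of_nonneg_left h (abs_nonneg _)
    _ ≤ ∑ i : Fin (N + 1), binomialWeight N i p * ((i : ℕ) - N * p) ^ 2 * (c * N)⁻¹ :=
        Finset.sum_le_sum_of_subset_of_nonneg (Finset.subset_univ _)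
          fun i _ _ => mul_nonneg (mul_nonneg (hw i) (sq_nonneg _)) (by positivity)
    _ = c⁻¹ * (p * (1 - p)) := by
        rw [← Finset.sum_mul, sum_sq_mul_binomialWeight]
        field_simp

/-- The density of the order statistic of rank `i + 1` among `N + 1` observations is `N + 1` times
a binomial weight times the density of one observation. -/
lemma orderStatDensity_succ (P : Measure ℝ) (f : ℝ → ℝ) (N : ℕ) (i : Fin (N + 1)) :
    orderStatDensity P f (N + 1) (i + 1) =
      fun x => (N + 1) * (binomialWeight N i (cdf P x) * f x) := by
  ext x
  have hi : (i : ℕ) ≤ N := Nat.lt_succ_iff.1 i.2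
  simp only [orderStatDensity, binomialWeight, Nat.add_sub_cancel, Nat.add_sub_add_right,
    Nat.cast_choose ℝ hi, Nat.factorial_succ]
  push_cast
  ring

lemma tendsto_div_keptCount (hα : α < 1 / 2) (hα0 : 0 ≤ α) :
    Tendsto (fun N : ℕ => (keptCount (N + 1) α)⁻¹ * ((N : ℝ) + 1)) atTop (𝓝 (1 - 2 * α)⁻¹) := by
  have h1 : Tendsto (fun n : ℕ => keptCount n α / n) atTop (𝓝 (1 - 2 * α)) := by
    have h2 : Tendsto (fun n : ℕ => (⌊α * (n : ℝ)⌋₊ : ℝ) / n) atTop (𝓝 α) :=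
      (tendsto_nat_floor_mul_div_atTop hα0).comp tendsto_natCast_atTop_atTop
    refine ((h2.const_mul 2).const_sub 1).congr' ?_
    filter_upwards [eventually_gt_atTop 0] with n hn
    have : (n : ℝ) ≠ 0 := by positivity
    rw [keptCount, mul_comm (n : ℝ) α]
    field_simp
  refine ((h1.comp (tendsto_add_atTop_nat 1)).inv₀ (by linarith)).congr fun N => ?_
  simp only [Function.comp_apply, inv_div]
  push_cast
  ring

lemma tendsto_avgDensity (P : Measure ℝ) (f : ℝ → ℝ) (x₀ : ℝ) (hα0 : 0 ≤ α)
    (hα : α < 1 / 2) (hl : α < cdf P x₀) (hr : cdf P x₀ < 1 - α) :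
    Tendsto (fun n => avgDensity P f α n x₀) atTop (𝓝 ((1 - 2 * α)⁻¹ * f x₀)) := by
  rw [← tendsto_add_atTop_iff_nat 1]
  have h := ((tendsto_div_keptCount hα hα0).mul (tendsto_sum_untrimmed hα0 hα hl hr)).mul_const
    (f x₀)
  rw [mul_one] at h
  refine h.congr fun N => ?_
  simp only [avgDensity, orderStatDensity_succ, ← Finset.mul_sum, ← Finset.sum_mul]
  ring

lemma avgDensityDeriv_isBigO (P : Measure ℝ) (f : ℝ → ℝ) (x₀ : ℝ) (hα0 : 0 ≤ α)
    (hα : α < 1 / 2) (hl : α < cdf P x₀) (hr : cdf P x₀ < 1 - α)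
    (hF : HasDerivAt (cdf P) (f x₀) x₀) (hf : DifferentiableAt ℝ f x₀) :
    (fun n => avgDensityDeriv P f α n x₀) =O[atTop] fun _ => (1 : ℝ) := by
  obtain ⟨c, hc, hc1, hc2⟩ : ∃ c, 0 < c ∧ α + c ≤ cdf P x₀ ∧ cdf P x₀ + c ≤ 1 - α :=
    ⟨min (cdf P x₀ - α) (1 - α - cdf P x₀), lt_min (by linarith) (by linarith),
      by linarith [min_le_left (cdf P x₀ - α) (1 - α - cdf P x₀)],
      by linarith [min_le_right (cdf P x₀ - α) (1 - α - cdf P x₀)]⟩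
  have hderiv (N : ℕ) (i : Fin (N + 1)) :
      deriv (orderStatDensity P f (N + 1) (i + 1)) x₀ = (N + 1) *
        (binomialWeight N i (cdf P x₀) * ((i : ℕ) - N * cdf P x₀) /
          (cdf P x₀ * (1 - cdf P x₀)) * f x₀ * f x₀ +
        binomialWeight N i (cdf P x₀) * deriv f x₀) := by
    rw [orderStatDensity_succ]
    have h1 := (hasDerivAt_binomialWeight (Nat.lt_succ_iff.1 i.2) (by linarith : 0 < cdf P x₀)
      (by linarith : cdf P x₀ < 1)).comp x₀ hF
    exact ((h1.mul hf.hasDerivAt).const_mul _).deriv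
  have hbd : (fun N : ℕ => ∑ i ∈ untrimmed (N + 1) α,
      binomialWeight N i (cdf P x₀) * ((i : ℕ) - N * cdf P x₀) /
        (cdf P x₀ * (1 - cdf P x₀))) =O[atTop] fun _ => (1 : ℝ) := by
    refine IsBigO.of_bound c⁻¹ ?_
    filter_upwards [eventually_gt_atTop 0] with N hN
    simpa using abs_sum_untrimmed_le hα0 hα hc hN hc1 hc2
  have hconst (b : ℝ) : (fun _ : ℕ => b) =O[atTop] fun _ => (1 : ℝ) :=
    isBigO_const_const b one_ne_zero atTop
  have hsum := (((hbd.mul (hconst (f x₀))).mul (hconst (f x₀))).congr_right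
    fun _ => by simp).add ((((tendsto_sum_untrimmed hα0 hα hl hr).isBigO_one ℝ).mul
      (hconst (deriv f x₀))).congr_right fun _ => by simp : _ =O[atTop] fun _ => (1 : ℝ))
  have h1 := ((tendsto_div_keptCount hα hα0).isBigO_one ℝ).mul hsum
  have h2 : (fun N => avgDensityDeriv P f α (N + 1) x₀) =O[atTop] fun _ => (1 : ℝ) := by
    refine h1.congr (fun N => ?_) (fun N => by simp)
    simp only [avgDensityDeriv, hderiv, ← Finset.mul_sum, ← Finset.sum_mul,
      Finset.sum_add_distrib]
    ring
  have h3 := h2.comp_tendsto (tendsto_sub_atTop_nat 1)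
  refine h3.congr' ?_ .rfl
  filter_upwards [eventually_gt_atTop 0] with n hn
  simp [Nat.sub_add_cancel hn]

end KeptRanks

/-! ### Limit theorems for triangular arrays with i.i.d. rows -/

section RowSums

variable {Ω E : Type*} [MeasurableSpace Ω] [MeasurableSpace E] {μ : Measure Ω}
  [IsProbabilityMeasure μ] {Z : ℕ → Ω → E} {ψ : ℕ → E → ℝ}

/-- Weak law of large numbers for the row sums of a triangular array. -/
lemma tendstoInMeasure_rowSum (hindep : iIndepFun Z μ)
    (hident : ∀ i, IdentDistrib (Z i) (Z 0) μ μ) (hψ : ∀ n, Measurable (ψ n)) {a : ℝ}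
    (hL2 : ∀ᶠ n in atTop, MemLp (fun ω => ψ n (Z 0 ω)) 2 μ)
    (hmean : Tendsto (fun n : ℕ => n * ∫ ω, ψ n (Z 0 ω) ∂μ) atTop (𝓝 a))
    (hsq : Tendsto (fun n : ℕ => n * ∫ ω, ψ n (Z 0 ω) ^ 2 ∂μ) atTop (𝓝 0)) :
    TendstoInMeasure μ (fun n ω => ∑ i : Fin n, ψ n (Z i ω)) atTop fun _ => a := by
  rw [tendstoInMeasure_iff_norm]
  intro ε hε
  have hε2 : 0 < ε / 2 := by positivity
  have hup : Tendsto (fun n : ℕ => ENNReal.ofReal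
      ((n * ∫ ω, ψ n (Z 0 ω) ^ 2 ∂μ) / (ε / 2) ^ 2)) atTop (𝓝 0) := by
    have := ENNReal.tendsto_ofReal (hsq.div_const ((ε / 2) ^ 2))
    simpa using this
  refine tendsto_of_tendsto_of_tendsto_of_le_of_le' tendsto_const_nhds hup
    (.of_forall fun _ => zero_le) ?_
  filter_upwards [hL2, Metric.tendsto_nhds.1 hmean (ε / 2) hε2] with n hn hn'
  have hid (i : ℕ) : IdentDistrib (fun ω => ψ n (Z i ω)) (fun ω => ψ n (Z 0 ω)) μ μ :=
    (hident i).comp (hψ n)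
  have hLp (i : ℕ) : MemLp (fun ω => ψ n (Z i ω)) 2 μ := (hid i).memLp_iff.2 hn
  have hEsum : ∫ ω, (∑ i : Fin n, fun ω => ψ n (Z i ω)) ω ∂μ = n * ∫ ω, ψ n (Z 0 ω) ∂μ := by
    simp only [Finset.sum_apply]
    rw [integral_finsetSum _ fun (i : Fin n) _ => (hLp i).integrable one_le_two]
    simp [(hid _).integral_eq]
  have hVsum : Var[∑ i : Fin n, fun ω => ψ n (Z i ω); μ] ≤ n * ∫ ω, ψ n (Z 0 ω) ^ 2 ∂μ := by
    rw [IndepFun.variance_sum fun (i : Fin n) _ => hLp i]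
    · simp only [(hid _).variance_eq, Finset.sum_const, Finset.card_univ, Fintype.card_fin,
        nsmul_eq_mul]
      gcongr
      exact variance_le_expectation_sq hn.aestronglyMeasurable
    · intro i _ j _ hij
      exact (hindep.indepFun (Fin.val_injective.ne hij)).comp (hψ n) (hψ n)
  have hcheb := meas_ge_le_variance_div_sq
    (memLp_finsetSum' Finset.univ fun (i : Fin n) _ => hLp i) hε2
  rw [hEsum] at hcheb
  refine ((measure_mono fun ω hω => ?_).trans hcheb).trans
    (ENNReal.ofReal_le_ofReal (by gcongr))
  simp only [Set.mem_ofPred_eq, Finset.sum_apply, Real.norm_eq_abs, Real.dist_eq] at hω hn' ⊢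
  linarith [abs_sub_le (∑ i : Fin n, ψ n (Z i ω)) (n * ∫ ω, ψ n (Z 0 ω) ∂μ) a]

lemma abs_rpow_le_one_add {a b : ℝ} (ha : 0 ≤ a) (hab : a ≤ b) (y : ℝ) :
    |y| ^ a ≤ 1 + |y| ^ b := by
  rcases le_total |y| 1 with h | h
  · linarith [Real.rpow_le_one (abs_nonneg y) h ha, Real.rpow_nonneg (abs_nonneg y) b]
  · linarith [Real.rpow_le_rpow_of_exponent_le h hab]

/-- The second order Taylor remainder of `exp (i y)` is at most a multiple of `|y| ^ (2 + δ)`,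
for small `y` because it is of third order and for large `y` because it is of second order. -/
lemma norm_exp_mul_I_sub_le {δ : ℝ} (hδ : 0 < δ) (hδ1 : δ ≤ 1) (y : ℝ) :
    ‖Complex.exp (y * Complex.I) - (1 + y * Complex.I - y ^ 2 / 2)‖ ≤ 4 * |y| ^ (2 + δ) := by
  have hsplit : |y| ^ (2 + δ) = |y| ^ 2 * |y| ^ δ := by
    rw [Real.rpow_add' (abs_nonneg y) (by linarith), Real.rpow_two]
  have hI : ‖(y : ℂ) * Complex.I‖ = |y| := by simp
  rcases le_total |y| 1 with h | h
  · have h1 := Complex.exp_bound (x := y * Complex.I) (by rwa [hI]) (n := 3) (by norm_num)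
    have h2 : ∑ m ∈ Finset.range 3, ((y : ℂ) * Complex.I) ^ m / (m.factorial : ℂ) =
        1 + y * Complex.I - y ^ 2 / 2 := by
      simp [Finset.sum_range_succ, Nat.factorial, mul_pow]
      ring
    rw [h2, hI] at h1
    refine h1.trans ?_
    have h3 : |y| ^ 3 ≤ |y| ^ (2 + δ) := by
      rw [← Real.rpow_natCast]
      rcases (abs_nonneg y).eq_or_lt with h0 | h0
      · rw [← h0, Real.zero_rpow (by norm_num), Real.zero_rpow (by linarith)]
      · exact Real.rpow_le_rpow_of_exponent_ge h0 h (by push_cast; linarith)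
    have h4 : ((Nat.succ 3 : ℕ) : ℝ) * ((Nat.factorial 3 : ℝ) * ((3 : ℕ) : ℝ))⁻¹ ≤ 4 := by
      norm_num [Nat.factorial]
    calc _ ≤ |y| ^ (2 + δ) * 4 := by gcongr
      _ = _ := mul_comm _ _
  · have h1 : ‖Complex.exp (y * Complex.I)‖ = 1 := Complex.norm_exp_ofReal_mul_I y
    have h2 : ‖(y : ℂ) ^ 2 / 2‖ = |y| ^ 2 / 2 := by simp
    have h3 : (1 : ℝ) ≤ |y| ^ δ := Real.one_le_rpow h hδ.le
    have h4 : ‖(1 : ℂ)‖ = 1 := norm_one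
    rw [hsplit]
    have h5 : |y| ^ 2 ≤ |y| ^ 2 * |y| ^ δ := le_mul_of_one_le_right (by positivity) h3
    calc _ ≤ ‖Complex.exp (y * Complex.I)‖ + ‖1 + y * Complex.I - (y : ℂ) ^ 2 / 2‖ :=
          norm_sub_le _ _
      _ ≤ 1 + (‖(1 : ℂ)‖ + ‖(y : ℂ) * Complex.I‖ + ‖(y : ℂ) ^ 2 / 2‖) := by
          rw [h1]
          gcongr
          exact (norm_sub_le _ _).trans (by gcongr; exact norm_add_le _ _)
      _ ≤ _ := by
          rw [h4, hI, h2]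
          nlinarith

/-- A centered variable with a moment of order `2 + δ` has a characteristic function close to
`1 - t² E[U²] / 2`, with an error controlled by that moment. -/
lemma norm_charFun_sub_le {U : Ω → ℝ} (hU : AEMeasurable U μ) {δ : ℝ} (hδ : 0 < δ) (hδ1 : δ ≤ 1)
    (hint : Integrable (fun ω => |U ω| ^ (2 + δ)) μ) (h0 : ∫ ω, U ω ∂μ = 0) (t : ℝ) :
    ‖charFun (μ.map U) t - (1 - (t ^ 2 / 2 * ∫ ω, U ω ^ 2 ∂μ : ℝ))‖ ≤
      4 * |t| ^ (2 + δ) * ∫ ω, |U ω| ^ (2 + δ) ∂μ := by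
  have hdom : Integrable (fun ω => 1 + |U ω| ^ (2 + δ)) μ := (integrable_const 1).add hint
  have h1 : Integrable U μ := hdom.mono' hU.aestronglyMeasurable (.of_forall fun ω => by
    simpa using abs_rpow_le_one_add zero_le_one (by linarith : 1 ≤ 2 + δ) (U ω))
  have h2 : Integrable (fun ω => U ω ^ 2) μ :=
    hdom.mono' (hU.pow_const 2).aestronglyMeasurable (.of_forall fun ω => by
      simpa using abs_rpow_le_one_add zero_le_two (by linarith : 2 ≤ 2 + δ) (U ω))
  have hexp : Integrable (fun ω => Complex.exp ((t * U ω : ℝ) * Complex.I)) μ := by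
    refine Integrable.of_bound (by fun_prop) 1 (.of_forall fun ω => ?_)
    rw [Complex.norm_exp_ofReal_mul_I]
  have hlin : Integrable (fun ω => 1 + ((t * U ω : ℝ) : ℂ) * Complex.I) μ :=
    (integrable_const 1).add ((h1.const_mul t).ofReal.mul_const _)
  have hquad : Integrable (fun ω => ((t * U ω : ℝ) : ℂ) ^ 2 / 2) μ := by
    refine ((h2.const_mul (t ^ 2 / 2)).ofReal (𝕜 := ℂ)).congr (.of_forall fun ω => ?_)
    simp
    ring
  have hchar : charFun (μ.map U) t = ∫ ω, Complex.exp ((t * U ω : ℝ) * Complex.I) ∂μ := by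
    rw [charFun_apply_real, integral_map hU (by fun_prop)]
    simp
  have htaylor : ∫ ω, (1 + ((t * U ω : ℝ) : ℂ) * Complex.I - ((t * U ω : ℝ) : ℂ) ^ 2 / 2 : ℂ) ∂μ =
      1 - ((t ^ 2 / 2 * ∫ ω, U ω ^ 2 ∂μ : ℝ) : ℂ) := by
    have hsq : ∫ ω, ((t * U ω : ℝ) : ℂ) ^ 2 / 2 ∂μ = ((t ^ 2 / 2 * ∫ ω, U ω ^ 2 ∂μ : ℝ) : ℂ) := by
      rw [← integral_const_mul, ← integral_complex_ofReal]
      congr 1 with ω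
      push_cast
      ring
    rw [integral_sub hlin hquad, integral_add (integrable_const _)
      ((h1.const_mul t).ofReal.mul_const _), integral_mul_const, integral_complex_ofReal,
      integral_const_mul, h0, hsq]
    simp
  rw [hchar, ← htaylor, ← integral_sub hexp (by exact hlin.sub hquad)]
  calc _ ≤ ∫ ω, 4 * |t| ^ (2 + δ) * |U ω| ^ (2 + δ) ∂μ := by
        refine norm_integral_le_of_norm_le (hint.const_mul _) (.of_forall fun ω => ?_)
        refine (norm_exp_mul_I_sub_le hδ hδ1 (t * U ω)).trans_eq ?_
        rw [abs_mul, Real.mul_rpow (abs_nonneg _) (abs_nonneg _), mul_assoc]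
    _ = _ := integral_const_mul _ _

/-- **Lyapunov's central limit theorem** for the row sums of a triangular array whose rows are
built from one i.i.d. sequence. -/
theorem tendstoInDistribution_rowSum {Ω' : Type*} [MeasurableSpace Ω'] {μ' : Measure Ω'}
    [IsProbabilityMeasure μ'] {W : Ω' → ℝ} {v : ℝ} (hv : 0 ≤ v)
    (hW : HasLaw W (gaussianReal 0 v.toNNReal) μ') (hindep : iIndepFun Z μ)
    (hident : ∀ i, IdentDistrib (Z i) (Z 0) μ μ) (hψ : ∀ n, Measurable (ψ n))
    {δ : ℝ} (hδ : 0 < δ) (hδ1 : δ ≤ 1)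
    (hint : ∀ n, Integrable (fun ω => |ψ n (Z 0 ω)| ^ (2 + δ)) μ)
    (h0 : ∀ n, ∫ ω, ψ n (Z 0 ω) ∂μ = 0)
    (hvar : Tendsto (fun n : ℕ => n * ∫ ω, ψ n (Z 0 ω) ^ 2 ∂μ) atTop (𝓝 v))
    (hlyap : Tendsto (fun n : ℕ => n * ∫ ω, |ψ n (Z 0 ω)| ^ (2 + δ) ∂μ) atTop (𝓝 0)) :
    TendstoInDistribution (fun (n : ℕ) ω => ∑ i : Fin n, ψ n (Z i ω)) atTop W (fun _ => μ) μ' where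
  forall_aemeasurable n := Finset.aemeasurable_fun_sum _ fun i _ =>
    (hψ n).comp_aemeasurable (hident i).aemeasurable_fst
  aemeasurable_limit := hW.aemeasurable
  tendsto := by
    have hm (n i : ℕ) : AEMeasurable (fun ω => ψ n (Z i ω)) μ :=
      (hψ n).comp_aemeasurable (hident i).aemeasurable_fst
    refine ProbabilityMeasure.tendsto_iff_tendsto_charFun.2 fun t => ?_
    have hpow (n : ℕ) : charFun (μ.map fun ω => ∑ i : Fin n, ψ n (Z i ω)) t =
        (1 + (charFun (μ.map fun ω => ψ n (Z 0 ω)) t - 1)) ^ n := by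
      have hi : iIndepFun (fun (i : Fin n) ω => ψ n (Z i ω)) μ :=
        (hindep.precomp Fin.val_injective).comp (fun _ => ψ n) fun _ => hψ n
      have hid (i : ℕ) : μ.map (fun ω => ψ n (Z i ω)) = μ.map fun ω => ψ n (Z 0 ω) :=
        ((hident i).comp (hψ n)).map_eq
      rw [hi.charFun_map_fun_sum_eq_prod fun i : Fin n => hm n i]
      simp [hid]
    simp only [ProbabilityMeasure.coe_mk, hpow, hW.map_eq, charFun_gaussianReal]
    have hlim : ((t : ℂ) * (0 : ℝ) * Complex.I - (v.toNNReal : ℝ) * (t : ℂ) ^ 2 / 2) =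
        ((-(t ^ 2 / 2 * v) : ℝ) : ℂ) := by
      rw [Real.coe_toNNReal v hv]
      push_cast
      ring
    rw [hlim]
    refine Complex.tendsto_one_add_pow_exp_of_tendsto ?_
    have herr : Tendsto (fun n : ℕ => (n : ℂ) * (charFun (μ.map fun ω => ψ n (Z 0 ω)) t -
        (1 - (t ^ 2 / 2 * ∫ ω, ψ n (Z 0 ω) ^ 2 ∂μ : ℝ)))) atTop (𝓝 0) := by
      have h1 := hlyap.const_mul (4 * |t| ^ (2 + δ))
      rw [mul_zero] at h1
      refine squeeze_zero_norm (fun n => ?_) h1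
      rw [norm_mul, Complex.norm_natCast]
      calc _ ≤ (n : ℝ) * (4 * |t| ^ (2 + δ) * ∫ ω, |ψ n (Z 0 ω)| ^ (2 + δ) ∂μ) := by
            gcongr
            exact norm_charFun_sub_le (hm n 0) hδ hδ1 (hint n) (h0 n) t
        _ = _ := by ring
    have hmain := (Complex.continuous_ofReal.tendsto _).comp (hvar.const_mul (t ^ 2 / 2)).neg
    have h2 := herr.add hmain
    rw [zero_add] at h2
    refine h2.congr fun n => ?_
    simp only [Function.comp_apply]
    push_cast
    ring

end RowSums

/-! ### Kernel integrals over a shrinking window -/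

section Window

variable {K W : ℝ → ℝ} {τ : ℝ} {x₀ : ℝ} {h : ℕ → ℝ}

/-- A kernel with support in `(-τ, τ)` acts on shrinking windows like a multiple of a point
mass. -/
lemma tendsto_integral_window (hW : Measurable W) {B : ℝ} (hWb : ∀ v, |W v| ≤ B)
    (hWsupp : ∀ v, τ ≤ |v| → W v = 0) {q : ℝ → ℝ} (hq : Measurable q)
    (hqc : ContinuousAt q x₀) (hh0 : Tendsto h atTop (𝓝 0)) :
    Tendsto (fun n => ∫ v, W v * q (x₀ + h n * v)) atTop (𝓝 ((∫ v, W v) * q x₀)) := by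
  rw [← integral_mul_const]
  have hpt (v : ℝ) : Tendsto (fun n => x₀ + h n * v) atTop (𝓝 x₀) := by
    simpa using (hh0.mul_const v).const_add x₀
  obtain ⟨η, hη, hbd⟩ := Metric.eventually_nhds_iff.1
    (hqc.norm.eventually_lt_const (lt_add_one ‖q x₀‖))
  refine tendsto_integral_filter_of_dominated_convergence
    ((Set.Icc (-τ) τ).indicator fun _ => B * (‖q x₀‖ + 1)) ?_ ?_ ?_ ?_
  · exact .of_forall fun n => by fun_prop
  · have hτ : Tendsto (fun n => |h n| * |τ|) atTop (𝓝 0) := by simpa using hh0.abs.mul_const |τ|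
    filter_upwards [hτ.eventually_lt_const hη] with n hn
    refine .of_forall fun v => ?_
    by_cases hv : |v| < τ
    · rw [Set.indicator_of_mem (Set.mem_Icc.2 (abs_le.1 hv.le)), norm_mul]
      have h1 : dist (x₀ + h n * v) x₀ < η := by
        rw [Real.dist_eq, add_sub_cancel_left, abs_mul]
        exact lt_of_le_of_lt (mul_le_mul_of_nonneg_left (hv.le.trans (le_abs_self τ))
          (abs_nonneg _)) hn
      exact mul_le_mul (hWb v) (hbd h1).le (norm_nonneg _) ((abs_nonneg _).trans (hWb v))
    · rw [hWsupp v (not_lt.1 hv), zero_mul, norm_zero]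
      refine Set.indicator_nonneg (fun _ _ => ?_) v
      have := (abs_nonneg _).trans (hWb 0)
      positivity
  · exact (integrable_indicator_iff measurableSet_Icc).2
      (integrableOn_const isCompact_Icc.measure_lt_top.ne)
  · exact .of_forall fun v => (hqc.tendsto.comp (hpt v)).const_mul (W v)

/-- For a centered kernel the linear term of the integrand disappears, so that the integral over a
window of width `h` is of order `h ^ 2`. -/
lemma integral_window_isBigO (hKm : Measurable K) (hK0 : ∀ u, 0 ≤ K u)
    (hKsupp : ∀ v, τ ≤ |v| → K v = 0) (hK1 : ∫ u, K u = 1) (hKmean : ∫ u, u * K u = 0)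
    {ρ : ℝ → ℝ} (hρ : Measurable ρ) {c : ℝ}
    (hρc : (fun x => ρ x - c * (x - x₀)) =O[𝓝 x₀] fun x => (x - x₀) ^ 2)
    (hh0 : Tendsto h atTop (𝓝 0)) :
    (fun n => ∫ v, K v * ρ (x₀ + h n * v)) =O[atTop] fun n => h n ^ 2 := by
  obtain ⟨L, hL⟩ := hρc.bound
  obtain ⟨η, hη, hbd⟩ := Metric.eventually_nhds_iff.1 hL
  have hKint : Integrable K := by
    by_contra hne
    simp [integral_undef hne] at hK1
  have hvK : Integrable fun v => v * K v := by
    refine (hKint.const_mul |τ|).mono' (by fun_prop) (.of_forall fun v => ?_)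
    by_cases hv : |v| < τ
    · rw [norm_mul, Real.norm_of_nonneg (hK0 v)]
      exact mul_le_mul_of_nonneg_right (hv.le.trans (le_abs_self τ)) (hK0 v)
    · simp [hKsupp v (not_lt.1 hv)]
  have hτ : Tendsto (fun n => |h n| * |τ|) atTop (𝓝 0) := by simpa using hh0.abs.mul_const |τ|
  refine IsBigO.of_bound (|L| * τ ^ 2) ?_
  filter_upwards [hτ.eventually_lt_const hη] with n hn
  have hrem (v : ℝ) : ‖K v * (ρ (x₀ + h n * v) - c * (h n * v))‖ ≤
      |L| * τ ^ 2 * h n ^ 2 * K v := by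
    by_cases hv : |v| < τ
    · have hle : |h n * v| ≤ |h n| * |τ| := by
        rw [abs_mul]
        exact mul_le_mul_of_nonneg_left (hv.le.trans (le_abs_self τ)) (abs_nonneg _)
      have h1 := hbd (y := x₀ + h n * v) (by
        rw [Real.dist_eq, add_sub_cancel_left]
        exact hle.trans_lt hn)
      rw [add_sub_cancel_left, norm_pow, Real.norm_eq_abs (h n * v)] at h1
      rw [norm_mul, Real.norm_of_nonneg (hK0 v), mul_comm]
      refine mul_le_mul_of_nonneg_right ?_ (hK0 v)
      calc _ ≤ L * |h n * v| ^ 2 := h1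
        _ ≤ |L| * (|h n| * |τ|) ^ 2 := by
            gcongr
            exact le_abs_self L
        _ = _ := by rw [mul_pow, sq_abs, sq_abs]; ring
    · simp [hKsupp v (not_lt.1 hv)]
  have hremint : Integrable fun v => K v * (ρ (x₀ + h n * v) - c * (h n * v)) :=
    (hKint.const_mul _).mono' (by fun_prop) (.of_forall hrem)
  have hsplit : ∫ v, K v * ρ (x₀ + h n * v) =
      ∫ v, K v * (ρ (x₀ + h n * v) - c * (h n * v)) := by
    calc _ = ∫ v, (K v * (ρ (x₀ + h n * v) - c * (h n * v)) + c * h n * (v * K v)) := by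
          congr 1 with v
          ring
      _ = _ := by
          rw [integral_add hremint (hvK.const_mul _), integral_const_mul, hKmean]
          simp
  rw [hsplit]
  refine (norm_integral_le_of_norm_le (hKint.const_mul _) (.of_forall hrem)).trans_eq ?_
  rw [integral_const_mul, hK1, mul_one, norm_pow, Real.norm_eq_abs, sq_abs]

/-- Taylor's theorem. The value of the slope plays no role, because the linear term cancels against
a centered kernel. -/
lemma exists_sub_linear_isBigO {g : ℝ → ℝ} {C : Set ℝ} (hC : x₀ ∈ interior C)
    (hg : ContDiffOn ℝ 2 g C) :
    ∃ c, (fun x => g x - g x₀ - c * (x - x₀)) =O[𝓝 x₀] fun x => (x - x₀) ^ 2 := by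
  obtain ⟨ε, hε, hball⟩ := Metric.isOpen_iff.1 isOpen_interior x₀ hC
  have hnhds : Metric.ball x₀ ε ∈ 𝓝 x₀ := Metric.ball_mem_nhds x₀ hε
  have ht := (taylor_isLittleO (convex_ball x₀ ε) (Metric.mem_ball_self hε)
    (n := 2) (hg.mono (hball.trans interior_subset))).isBigO
  rw [nhdsWithin_eq_nhds.2 hnhds] at ht
  refine ⟨iteratedDerivWithin 1 g (Metric.ball x₀ ε) x₀, ?_⟩
  have hsq : (fun x => iteratedDerivWithin 2 g (Metric.ball x₀ ε) x₀ / 2 * (x - x₀) ^ 2) =O[𝓝 x₀]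
      fun x => (x - x₀) ^ 2 := (isBigO_refl _ _).const_mul_left _
  refine (ht.add hsq).congr_left fun x => ?_
  simp [taylorWithinEval_succ]
  ring

lemma exists_mul_sub_linear_isBigO {g f : ℝ → ℝ} {C : Set ℝ} (hC : x₀ ∈ interior C)
    (hg : ContDiffOn ℝ 2 g C) (hf : DifferentiableAt ℝ f x₀) :
    ∃ c, (fun x => (g x - g x₀) * f x - c * (x - x₀)) =O[𝓝 x₀] fun x => (x - x₀) ^ 2 := by
  obtain ⟨c, hc⟩ := exists_sub_linear_isBigO hC hg
  refine ⟨c * f x₀, ?_⟩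
  have h1 := hc.mul (hf.continuousAt.tendsto.isBigO_one ℝ)
  have h2 := ((isBigO_refl (fun x => x - x₀) (𝓝 x₀)).const_mul_left c).mul hf.isBigO_sub
  refine ((h1.congr_right fun x => mul_one _).add
    (h2.congr_right fun x => (sq _).symm)).congr_left fun x => ?_
  ring

end Window

/-! ### Moments of a kernel weight under a density -/

section Density

variable {Ω : Type*} [MeasurableSpace Ω] {μ : Measure Ω} {X : Ω → ℝ} {f : ℝ → ℝ}

lemma integral_comp_eq_integral_mul (hX : Measurable X) (hfm : Measurable f) (hf0 : ∀ x, 0 ≤ f x)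
    (hfX : μ.map X = volume.withDensity fun x => ENNReal.ofReal (f x))
    {φ : ℝ → ℝ} (hφ : Measurable φ) : ∫ ω, φ (X ω) ∂μ = ∫ x, φ x * f x := by
  rw [← integral_map hX.aemeasurable hφ.aestronglyMeasurable, hfX,
    integral_withDensity_eq_integral_toReal_smul (by fun_prop) (by simp)]
  congr 1 with x
  rw [ENNReal.toReal_ofReal (hf0 x), smul_eq_mul, mul_comm]

/-- The substitution `x = x₀ + h v` in the expectation of a kernel weight. -/
lemma integral_kernel_mul (hX : Measurable X) (hfm : Measurable f) (hf0 : ∀ x, 0 ≤ f x)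
    (hfX : μ.map X = volume.withDensity fun x => ENNReal.ofReal (f x))
    {W r : ℝ → ℝ} (hW : Measurable W) (hr : Measurable r) {h : ℝ} (hh : 0 < h) (x₀ : ℝ) :
    ∫ ω, W ((X ω - x₀) / h) * r (X ω) ∂μ =
      h * ∫ v, W v * (r (x₀ + h * v) * f (x₀ + h * v)) := by
  rw [integral_comp_eq_integral_mul hX hfm hf0 hfX (φ := fun x => W ((x - x₀) / h) * r x)
    (by fun_prop)]
  have h1 := Measure.integral_comp_div (fun v => W v * (r (x₀ + h * v) * f (x₀ + h * v))) h
  rw [smul_eq_mul, abs_of_pos hh] at h1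
  rw [← h1, ← integral_sub_right_eq_self
    (fun x => W (x / h) * (r (x₀ + h * (x / h)) * f (x₀ + h * (x / h)))) x₀]
  congr 1 with x
  rw [mul_div_cancel₀ _ hh.ne', add_sub_cancel, mul_assoc]

lemma hasDerivAt_cdf {P : Measure ℝ} [IsProbabilityMeasure P] {x₀ : ℝ} (hfm : Measurable f)
    (hf0 : ∀ x, 0 ≤ f x) (hP : P = volume.withDensity fun x => ENNReal.ofReal (f x))
    (hfc : ContinuousAt f x₀) : HasDerivAt (cdf P) (f x₀) x₀ := by
  have hint : Integrable f := by
    refine ⟨hfm.aestronglyMeasurable, ?_⟩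
    rw [hasFiniteIntegral_iff_ofReal (.of_forall hf0), ← setLIntegral_univ,
      ← withDensity_apply _ .univ, ← hP]
    exact measure_lt_top P _
  have hcdf (x : ℝ) : cdf P x = (∫ u in x₀..x, f u) + ∫ u in Set.Iic x₀, f u := by
    rw [← intervalIntegral.integral_Iic_sub_Iic hint.integrableOn hint.integrableOn,
      sub_add_cancel, cdf_eq_real, Measure.real, hP, withDensity_apply _ measurableSet_Iic,
      ← ofReal_integral_eq_lintegral_ofReal hint.integrableOn (.of_forall hf0),
      ENNReal.toReal_ofReal (integral_nonneg hf0)]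
  have h1 := (intervalIntegral.integral_hasDerivAt_right (a := x₀) hint.intervalIntegrable
    (hfm.stronglyMeasurable.stronglyMeasurableAtFilter) hfc).add_const
      (∫ u in Set.Iic x₀, f u)
  exact h1.congr_of_eventuallyEq (.of_forall hcdf)

/-- A bounded function of `X` sees a variable only through its conditional expectation given
`X`. -/
lemma integral_comp_mul_eq_integral_mul_condExp [IsProbabilityMeasure μ] (hX : Measurable X)
    {φ : ℝ → ℝ} (hφ : Measurable φ) {B : ℝ} (hφb : ∀ x, |φ x| ≤ B) {V : Ω → ℝ}
    (hV : Integrable V μ) :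
    ∫ ω, φ (X ω) * V ω ∂μ =
      ∫ ω, φ (X ω) * (μ[V | MeasurableSpace.comap X inferInstance]) ω ∂μ := by
  have hm : MeasurableSpace.comap X inferInstance ≤ (inferInstance : MeasurableSpace Ω) :=
    hX.comap_le
  have h1 := condExp_stronglyMeasurable_mul_of_bound (μ := μ) hm (f := fun ω => φ (X ω)) (g := V)
    (hφ.comp (comap_measurable X)).stronglyMeasurable hV B (.of_forall fun ω => hφb (X ω))
  rw [← integral_condExp hm]
  exact integral_congr_ae h1

end Density

/-! ### The kernel sums in the numerator and the denominator -/

section KernelSums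

variable {Ω : Type*} [MeasurableSpace Ω] {μ : Measure Ω}
  {X : ℕ → Ω → ℝ} {f g K W : ℝ → ℝ} {τ x₀ B : ℝ} {h : ℕ → ℝ}

lemma tendsto_inv_mul_integral_kernel {X : Ω → ℝ} (hX : Measurable X) (hfm : Measurable f)
    (hf0 : ∀ x, 0 ≤ f x) (hfX : μ.map X = volume.withDensity fun x => ENNReal.ofReal (f x))
    (hfc : ContinuousAt f x₀) (hW : Measurable W) (hWb : ∀ v, |W v| ≤ B)
    (hWsupp : ∀ v, τ ≤ |v| → W v = 0) {r : ℝ → ℝ} (hr : Measurable r) (hrc : ContinuousAt r x₀)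
    (hhpos : ∀ n, 0 < h n) (hh0 : Tendsto h atTop (𝓝 0)) :
    Tendsto (fun n => (h n)⁻¹ * ∫ ω, W ((X ω - x₀) / h n) * r (X ω) ∂μ) atTop
      (𝓝 ((∫ v, W v) * (r x₀ * f x₀))) := by
  refine (tendsto_integral_window hW hWb hWsupp (hr.mul hfm) (hrc.mul hfc) hh0).congr fun n => ?_
  rw [integral_kernel_mul hX hfm hf0 hfX hW hr (hhpos n), ← mul_assoc,
    inv_mul_cancel₀ (hhpos n).ne', one_mul]
  rfl

lemma tendsto_zero_of_isBigO_rpow (hh : h =O[atTop] fun n : ℕ => (n : ℝ) ^ (-(1 / 3 : ℝ))) :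
    Tendsto h atTop (𝓝 0) :=
  hh.trans_tendsto ((tendsto_rpow_neg_atTop (by norm_num)).comp tendsto_natCast_atTop_atTop)

/-- With bandwidths of order `n ^ (-1/3)`, terms of order `h ^ 2` vanish at the rate of the limit
theorem: the square of the product is `(n h ^ 3) h ^ 2`. -/
lemma tendsto_sqrt_mul_sq
    (hh : h =O[atTop] fun n : ℕ => (n : ℝ) ^ (-(1 / 3 : ℝ))) :
    Tendsto (fun n : ℕ => √(n * h n) * h n ^ 2) atTop (𝓝 0) := by
  have hh0 := tendsto_zero_of_isBigO_rpow hh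
  have h1 : (fun n : ℕ => (n : ℝ) * h n ^ 3) =O[atTop] fun _ => (1 : ℝ) := by
    refine ((isBigO_refl (fun n : ℕ => (n : ℝ)) atTop).mul (hh.pow 3)).congr' .rfl ?_
    filter_upwards [eventually_gt_atTop 0] with n hn
    have hn' : (0 : ℝ) < n := Nat.cast_pos.2 hn
    rw [← Real.rpow_natCast, ← Real.rpow_mul hn'.le]
    norm_num [Real.rpow_neg_one, hn'.ne']
  have h2 : Tendsto (fun n : ℕ => (n : ℝ) * h n ^ 3 * h n ^ 2) atTop (𝓝 0) := by
    have h3 : Tendsto (fun n => h n ^ 2) atTop (𝓝 0) := by simpa using hh0.pow 2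
    exact (h1.mul (isBigO_refl _ _)).trans_tendsto (by simpa using h3)
  have h4 := (Real.continuous_sqrt.tendsto 0).comp h2
  rw [Real.sqrt_zero] at h4
  refine h4.congr fun n => ?_
  have : (n : ℝ) * h n ^ 3 * h n ^ 2 = n * h n * (h n ^ 2) ^ 2 := by ring
  rw [Function.comp_apply, this, Real.sqrt_mul' _ (sq_nonneg _), Real.sqrt_sq (sq_nonneg _)]

variable [IsProbabilityMeasure μ]

/-- The kernel density estimate at `x₀` is consistent. -/
lemma tendstoInMeasure_denominator (hX : ∀ i, Measurable (X i)) (hindep : iIndepFun X μ)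
    (hident : ∀ i, IdentDistrib (X i) (X 0) μ μ) (hfm : Measurable f) (hf0 : ∀ x, 0 ≤ f x)
    (hfX : μ.map (X 0) = volume.withDensity fun x => ENNReal.ofReal (f x))
    (hfc : ContinuousAt f x₀) (hKm : Measurable K) (hKb : ∀ v, |K v| ≤ B)
    (hKsupp : ∀ v, τ ≤ |v| → K v = 0) (hK1 : ∫ u, K u = 1)
    (hhpos : ∀ n, 0 < h n) (hh0 : Tendsto h atTop (𝓝 0))
    (hnh : Tendsto (fun n : ℕ => (n : ℝ) * h n) atTop atTop) :
    TendstoInMeasure μ (fun (n : ℕ) ω => ∑ i : Fin n, K ((X i ω - x₀) / h n) / (n * h n)) atTop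
      fun _ => f x₀ := by
  refine tendstoInMeasure_rowSum (ψ := fun (n : ℕ) x => K ((x - x₀) / h n) / (n * h n)) hindep
    hident (by fun_prop) (.of_forall fun n => ?_) ?_ ?_
  · refine MemLp.of_bound (Measurable.aestronglyMeasurable (by have := hX 0; fun_prop))
      (B / |n * h n|) (.of_forall fun ω => ?_)
    rw [norm_div, Real.norm_eq_abs, Real.norm_eq_abs]
    gcongr
    exact hKb _
  · have h1 := tendsto_inv_mul_integral_kernel (hX 0) hfm hf0 hfX hfc hKm hKb hKsupp
      (r := fun _ => 1) measurable_const continuousAt_const hhpos hh0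
    simp only [hK1, one_mul, mul_one] at h1
    refine h1.congr' ?_
    filter_upwards [eventually_gt_atTop 0] with n hn
    have hn' : (n : ℝ) ≠ 0 := by positivity
    rw [integral_div]
    have := (hhpos n).ne'
    field_simp
  · have h1 := tendsto_inv_mul_integral_kernel (W := fun v => K v ^ 2) (B := B ^ 2) (τ := τ)
      (hX 0) hfm hf0 hfX hfc (by fun_prop)
      (fun v => by rw [abs_pow]; exact pow_le_pow_left₀ (abs_nonneg _) (hKb v) 2)
      (fun v hv => by simp [hKsupp v hv])
      (r := fun _ => 1) measurable_const continuousAt_const hhpos hh0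
    have h2 := (tendsto_inv_atTop_zero.comp hnh).mul h1
    rw [zero_mul] at h2
    refine h2.congr' ?_
    filter_upwards [eventually_gt_atTop 0] with n hn
    have hn' : (n : ℝ) ≠ 0 := by positivity
    simp only [div_pow, mul_one, Function.comp_apply]
    rw [integral_div]
    have := (hhpos n).ne'
    field_simp

/-- The bias of the estimator is negligible: its mean is of order `√(n h) h ^ 2`, and its variance
vanishes because `g` is continuous at `x₀`. -/
lemma tendstoInMeasure_bias (hX : ∀ i, Measurable (X i)) (hindep : iIndepFun X μ)
    (hident : ∀ i, IdentDistrib (X i) (X 0) μ μ) (hfm : Measurable f) (hf0 : ∀ x, 0 ≤ f x)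
    (hfX : μ.map (X 0) = volume.withDensity fun x => ENNReal.ofReal (f x))
    (hfd : DifferentiableAt ℝ f x₀) (hg : Measurable g) {C : Set ℝ} (hx₀C : x₀ ∈ interior C)
    (hgC : ContDiffOn ℝ 2 g C) (hKm : Measurable K) (hK0 : ∀ v, 0 ≤ K v) (hKb : ∀ v, |K v| ≤ B)
    (hKsupp : ∀ v, τ ≤ |v| → K v = 0) (hK1 : ∫ u, K u = 1) (hKmean : ∫ u, u * K u = 0)
    (hhpos : ∀ n, 0 < h n) (hh0 : Tendsto h atTop (𝓝 0))
    (hhsq : Tendsto (fun n : ℕ => √(n * h n) * h n ^ 2) atTop (𝓝 0)) :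
    TendstoInMeasure μ
      (fun (n : ℕ) ω => ∑ i : Fin n, K ((X i ω - x₀) / h n) * (g (X i ω) - g x₀) / √(n * h n))
      atTop fun _ => 0 := by
  have hgc : ContinuousAt g x₀ := hgC.continuousOn.continuousAt (mem_interior_iff_mem_nhds.1 hx₀C)
  refine tendstoInMeasure_rowSum
    (ψ := fun (n : ℕ) x => K ((x - x₀) / h n) * (g x - g x₀) / √(n * h n)) hindep
    hident (by fun_prop) ?_ ?_ ?_
  · obtain ⟨η, hη, hbd⟩ := Metric.eventually_nhds_iff.1
      (((hgc.sub_const (g x₀)).norm).eventually_lt_const (lt_add_one ‖g x₀ - g x₀‖))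
    have hτ : Tendsto (fun n => h n * τ) atTop (𝓝 0) := by simpa using hh0.mul_const τ
    filter_upwards [hτ.eventually_lt_const hη] with n hn
    refine MemLp.of_bound (Measurable.aestronglyMeasurable (by have := hX 0; fun_prop))
      (B * 1 / |√(n * h n)|) (.of_forall fun ω => ?_)
    rw [norm_div, Real.norm_eq_abs (√_)]
    gcongr
    by_cases hv : |(X 0 ω - x₀) / h n| < τ
    · rw [abs_div, abs_of_pos (hhpos n), div_lt_iff₀ (hhpos n)] at hv
      have h1 := hbd (y := X 0 ω) (by rw [Real.dist_eq]; linarith)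
      rw [norm_mul]
      refine mul_le_mul (hKb _) ?_ (norm_nonneg _) ((abs_nonneg _).trans (hKb 0))
      simpa using h1.le
    · rw [hKsupp _ (not_lt.1 hv), zero_mul, norm_zero, mul_one]
      exact (abs_nonneg _).trans (hKb 0)
  · obtain ⟨c, hc⟩ := exists_mul_sub_linear_isBigO hx₀C hgC hfd
    have h1 := integral_window_isBigO hKm hK0 hKsupp hK1 hKmean
      (ρ := fun x => (g x - g x₀) * f x) (by fun_prop) hc hh0
    have h2 := ((isBigO_refl (fun n : ℕ => √(n * h n)) atTop).mul h1).trans_tendsto hhsq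
    refine h2.congr fun n => ?_
    have h3 := integral_kernel_mul (hX 0) hfm hf0 hfX hKm (hg.sub_const (g x₀)) (hhpos n) x₀
    rw [integral_div, h3]
    have h4 : √(n * h n) = n * h n / √(n * h n) := (Real.div_sqrt).symm
    conv_lhs => rw [h4]
    ring
  · have h1 := tendsto_inv_mul_integral_kernel (W := fun v => K v ^ 2) (B := B ^ 2) (τ := τ)
      (hX 0) hfm hf0 hfX hfd.continuousAt (by fun_prop)
      (fun v => by rw [abs_pow]; exact pow_le_pow_left₀ (abs_nonneg _) (hKb v) 2)
      (fun v hv => by simp [hKsupp v hv])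
      (r := fun x => (g x - g x₀) ^ 2) (by fun_prop) ((hgc.sub_const (g x₀)).pow 2) hhpos hh0
    simp only [sub_self, ne_eq, OfNat.ofNat_ne_zero, not_false_eq_true, zero_pow, zero_mul,
      mul_zero] at h1
    refine h1.congr' ?_
    filter_upwards [eventually_gt_atTop 0] with n hn
    have hn' : (n : ℝ) ≠ 0 := by positivity
    have := hhpos n
    simp only [div_pow, mul_pow, Real.sq_sqrt (by positivity : 0 ≤ (n : ℝ) * h n)]
    rw [integral_div]
    field_simp

/-- The empirical frequency of `s` converges to its probability. -/
lemma tendstoInMeasure_empirical (hX : ∀ i, Measurable (X i)) (hindep : iIndepFun X μ)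
    (hident : ∀ i, IdentDistrib (X i) (X 0) μ μ) {s : Set ℝ} (hs : MeasurableSet s) :
    TendstoInMeasure μ (fun (n : ℕ) ω => ∑ i : Fin n, s.indicator (fun _ => (1 : ℝ)) (X i ω) / n)
      atTop fun _ => (μ.map (X 0)).real s := by
  have hm : Measurable (s.indicator fun _ => (1 : ℝ)) := measurable_const.indicator hs
  have hint : ∫ ω, s.indicator (fun _ => (1 : ℝ)) (X 0 ω) ∂μ = (μ.map (X 0)).real s := by
    rw [← integral_map (hX 0).aemeasurable hm.aestronglyMeasurable, integral_indicator hs]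
    simp
  refine tendstoInMeasure_rowSum (ψ := fun (n : ℕ) x => s.indicator (fun _ => (1 : ℝ)) x / n)
    hindep hident (by fun_prop) (.of_forall fun n => ?_) ?_ ?_
  · refine MemLp.of_bound (Measurable.aestronglyMeasurable (by have := hX 0; fun_prop))
      (1 / |(n : ℝ)|) (.of_forall fun ω => ?_)
    rw [norm_div, Real.norm_eq_abs (n : ℝ)]
    gcongr
    simpa using norm_indicator_le_norm_self (s := s) (fun _ : ℝ => (1 : ℝ)) (X 0 ω)
  · refine tendsto_const_nhds.congr' ?_
    filter_upwards [eventually_gt_atTop 0] with n hn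
    have hn' : (n : ℝ) ≠ 0 := by positivity
    rw [integral_div, hint]
    field_simp
  · have h1 := (tendsto_inv_atTop_nhds_zero_nat (𝕜 := ℝ)).mul_const ((μ.map (X 0)).real s)
    rw [zero_mul] at h1
    refine h1.congr' ?_
    filter_upwards [eventually_gt_atTop 0] with n hn
    have hn' : (n : ℝ) ≠ 0 := by positivity
    have hsq (x : ℝ) : s.indicator (fun _ => (1 : ℝ)) x ^ 2 = s.indicator (fun _ => (1 : ℝ)) x := by
      by_cases hx : x ∈ s <;> simp [hx]
    simp only [div_pow, hsq]
    rw [integral_div, hint]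
    field_simp

end KernelSums

/-! ### The noise term -/

section Noise

variable {Ω : Type*} [MeasurableSpace Ω] {μ : Measure Ω}
  {X e : ℕ → Ω → ℝ} {f K σsq : ℝ → ℝ} {τ x₀ B : ℝ} {h : ℕ → ℝ}

/-- The central limit theorem for the kernel weighted errors. Their variance comes from the
conditional variance at `x₀`, and the conditional moment of order `2 + δ` near `x₀` gives the
Lyapunov condition. -/
lemma tendstoInDistribution_noise [IsProbabilityMeasure μ] {Ω' : Type*}
    [MeasurableSpace Ω'] {μ' : Measure Ω'} [IsProbabilityMeasure μ'] {G : Ω' → ℝ}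
    (hX : ∀ i, Measurable (X i)) (he : ∀ i, Measurable (e i))
    (hindep : iIndepFun (fun i ω => (X i ω, e i ω)) μ)
    (hident : ∀ i, IdentDistrib (fun ω => (X i ω, e i ω)) (fun ω => (X 0 ω, e 0 ω)) μ μ)
    (hfm : Measurable f) (hf0 : ∀ x, 0 ≤ f x)
    (hfX : μ.map (X 0) = volume.withDensity fun x => ENNReal.ofReal (f x))
    (hfc : ContinuousAt f x₀) (hKm : Measurable K) (hK0 : ∀ v, 0 ≤ K v) (hKb : ∀ v, K v ≤ B)
    (hKsupp : ∀ v, τ ≤ |v| → K v = 0)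
    (hhpos : ∀ n, 0 < h n) (hh0 : Tendsto h atTop (𝓝 0))
    (hnh : Tendsto (fun n : ℕ => (n : ℝ) * h n) atTop atTop)
    (hemean : μ[e 0 | MeasurableSpace.comap (X 0) inferInstance] =ᵐ[μ] 0)
    (hσm : Measurable σsq)
    (hevar : μ[fun ω => e 0 ω ^ 2 | MeasurableSpace.comap (X 0) inferInstance]
      =ᵐ[μ] fun ω => σsq (X 0 ω))
    (hσc : ContinuousAt σsq x₀) {δ M r : ℝ} (hδ : 0 < δ)
    (hint : Integrable (fun ω => |e 0 ω| ^ (2 + δ)) μ) (hr : 0 < r)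
    (hM : ∀ᵐ ω ∂μ, |X 0 ω - x₀| < r →
      (μ[fun ω => |e 0 ω| ^ (2 + δ) | MeasurableSpace.comap (X 0) inferInstance]) ω ≤ M)
    (hv : 0 ≤ (∫ v, K v ^ 2) * (σsq x₀ * f x₀))
    (hG : HasLaw G (gaussianReal 0 ((∫ v, K v ^ 2) * (σsq x₀ * f x₀)).toNNReal) μ') :
    TendstoInDistribution
      (fun (n : ℕ) ω => ∑ i : Fin n, K ((X i ω - x₀) / h n) * e i ω / √(n * h n))
      atTop G (fun _ => μ) μ' := by
  have hX0 := hX 0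
  have he0 := he 0
  set δ' := min δ 1
  have hδ' : 0 < δ' := lt_min hδ one_pos
  have hpow (y : ℝ) : |y| ^ (2 + δ') ≤ 1 + |y| ^ (2 + δ) :=
    abs_rpow_le_one_add (by linarith) (by linarith [min_le_left δ 1]) y
  have hdom : Integrable (fun ω => 1 + |e 0 ω| ^ (2 + δ)) μ := (integrable_const 1).add hint
  have he1 : Integrable (e 0) μ := hdom.mono' he0.aestronglyMeasurable (.of_forall fun ω => by
    simpa using abs_rpow_le_one_add zero_le_one (by linarith : 1 ≤ 2 + δ) (e 0 ω))
  have he2 : Integrable (fun ω => e 0 ω ^ 2) μ :=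
    hdom.mono' (Measurable.aestronglyMeasurable (by fun_prop)) (.of_forall fun ω => by
      simpa using abs_rpow_le_one_add zero_le_two (by linarith : 2 ≤ 2 + δ) (e 0 ω))
  have hKp (p : ℝ) (hp : 0 < p) (v : ℝ) : |K v ^ p| ≤ B ^ p := by
    rw [abs_of_nonneg (Real.rpow_nonneg (hK0 v) p)]
    exact Real.rpow_le_rpow (hK0 v) (hKb v) hp.le
  have hp : 0 < 2 + δ' := by linarith
  -- a bound for the absolute moment of order `2 + δ'` of a single term
  have habs (n : ℕ) (x y : ℝ) : |K ((x - x₀) / h n) * y / √(n * h n)| ^ (2 + δ') =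
      K ((x - x₀) / h n) ^ (2 + δ') * |y| ^ (2 + δ') / √(n * h n) ^ (2 + δ') := by
    rw [abs_div, abs_mul, abs_of_nonneg (hK0 _), abs_of_nonneg (Real.sqrt_nonneg _),
      Real.div_rpow (mul_nonneg (hK0 _) (abs_nonneg _)) (Real.sqrt_nonneg _),
      Real.mul_rpow (hK0 _) (abs_nonneg _)]
  have hKdom (n : ℕ) : Integrable
      (fun ω => K ((X 0 ω - x₀) / h n) ^ (2 + δ') * (1 + |e 0 ω| ^ (2 + δ))) μ :=
    hdom.bdd_mul (Measurable.aestronglyMeasurable (by fun_prop)) (.of_forall fun ω => hKp _ hp _)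
  refine tendstoInDistribution_rowSum (Z := fun i ω => (X i ω, e i ω))
    (ψ := fun (n : ℕ) z => K ((z.1 - x₀) / h n) * z.2 / √(n * h n))
    hv hG hindep hident (by fun_prop) hδ' (min_le_right δ 1) (fun n => ?_) (fun n => ?_) ?_ ?_
  · simp only [habs]
    refine ((hKdom n).div_const (√(n * h n) ^ (2 + δ'))).mono'
      (Measurable.aestronglyMeasurable (by fun_prop))
      (.of_forall fun ω => ?_)
    have h1 := Real.rpow_nonneg (hK0 ((X 0 ω - x₀) / h n)) (2 + δ')
    rw [Real.norm_of_nonneg (by positivity)]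
    gcongr
    exact hpow _
  · rw [integral_div, integral_comp_mul_eq_integral_mul_condExp hX0
      (φ := fun x => K ((x - x₀) / h n)) (by fun_prop) (B := B)
      (fun x => by rw [abs_of_nonneg (hK0 _)]; exact hKb _) he1]
    have : ∫ ω, K ((X 0 ω - x₀) / h n) *
        (μ[e 0 | MeasurableSpace.comap (X 0) inferInstance]) ω ∂μ = 0 := by
      refine integral_eq_zero_of_ae ?_
      filter_upwards [hemean] with ω hω
      simp [hω]
    rw [this, zero_div]
  · have h1 := tendsto_inv_mul_integral_kernel (W := fun v => K v ^ 2) (B := B ^ 2) (τ := τ)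
      hX0 hfm hf0 hfX hfc (by fun_prop)
      (fun v => by rw [abs_pow, abs_of_nonneg (hK0 v)]; exact pow_le_pow_left₀ (hK0 v) (hKb v) 2)
      (fun v hv => by simp [hKsupp v hv]) hσm hσc hhpos hh0
    refine h1.congr' ?_
    filter_upwards [eventually_gt_atTop 0] with n hn
    have hn' : (n : ℝ) ≠ 0 := by positivity
    have := hhpos n
    simp only [div_pow, mul_pow, Real.sq_sqrt (by positivity : 0 ≤ (n : ℝ) * h n)]
    rw [integral_div, integral_comp_mul_eq_integral_mul_condExp hX0
      (φ := fun x => K ((x - x₀) / h n) ^ 2) (by fun_prop) (B := B ^ 2)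
      (fun x => by rw [abs_pow, abs_of_nonneg (hK0 _)]; exact pow_le_pow_left₀ (hK0 _) (hKb _) 2)
      he2]
    have hc : ∫ ω, K ((X 0 ω - x₀) / h n) ^ 2 *
        (μ[fun ω => e 0 ω ^ 2 | MeasurableSpace.comap (X 0) inferInstance]) ω ∂μ =
        ∫ ω, K ((X 0 ω - x₀) / h n) ^ 2 * σsq (X 0 ω) ∂μ := by
      refine integral_congr_ae ?_
      filter_upwards [hevar] with ω hω
      rw [hω]
    rw [hc]
    field_simp
  · have h1 := tendsto_inv_mul_integral_kernel (W := fun v => K v ^ (2 + δ')) (B := B ^ (2 + δ'))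
      (τ := τ) hX0 hfm hf0 hfX hfc (by fun_prop) (hKp _ hp)
      (fun v hv => by simp [hKsupp v hv, hp.ne']) (r := fun _ => 1) measurable_const
      continuousAt_const hhpos hh0
    have h2 : Tendsto (fun n : ℕ => √(n * h n) ^ (-δ')) atTop (𝓝 0) :=
      (tendsto_rpow_neg_atTop hδ').comp (Real.tendsto_sqrt_atTop.comp hnh)
    have h3 := (h2.mul (h1.const_mul (1 + M)))
    rw [zero_mul] at h3
    have hτ : Tendsto (fun n => h n * τ) atTop (𝓝 0) := by simpa using hh0.mul_const τ
    refine tendsto_of_tendsto_of_tendsto_of_le_of_le' tendsto_const_nhds h3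
      (.of_forall fun n => by positivity) ?_
    filter_upwards [hτ.eventually_lt_const hr, eventually_gt_atTop 0] with n hn hn0
    have hn' : (0 : ℝ) < n := Nat.cast_pos.2 hn0
    have hs : 0 < √(n * h n) := Real.sqrt_pos.2 (mul_pos hn' (hhpos n))
    have hbd : ∫ ω, K ((X 0 ω - x₀) / h n) ^ (2 + δ') * |e 0 ω| ^ (2 + δ') ∂μ ≤
        (1 + M) * ∫ ω, K ((X 0 ω - x₀) / h n) ^ (2 + δ') * 1 ∂μ := by
      calc _ ≤ ∫ ω, K ((X 0 ω - x₀) / h n) ^ (2 + δ') * (1 + |e 0 ω| ^ (2 + δ)) ∂μ := by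
            refine integral_mono_of_nonneg (.of_forall fun ω => ?_) (hKdom n)
              (.of_forall fun ω => ?_)
            · exact mul_nonneg (Real.rpow_nonneg (hK0 _) _) (by positivity)
            · exact mul_le_mul_of_nonneg_left (hpow _) (Real.rpow_nonneg (hK0 _) _)
        _ = ∫ ω, K ((X 0 ω - x₀) / h n) ^ (2 + δ') * (μ[fun ω => 1 + |e 0 ω| ^ (2 + δ) |
              MeasurableSpace.comap (X 0) inferInstance]) ω ∂μ :=
            integral_comp_mul_eq_integral_mul_condExp hX0
              (φ := fun x => K ((x - x₀) / h n) ^ (2 + δ')) (by fun_prop) (fun x => hKp _ hp _) hdom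
        _ ≤ ∫ ω, (1 + M) * (K ((X 0 ω - x₀) / h n) ^ (2 + δ') * 1) ∂μ := by
            refine integral_mono_ae ?_ ?_ ?_
            · exact integrable_condExp.bdd_mul (Measurable.aestronglyMeasurable (by fun_prop))
                (.of_forall fun ω => hKp _ hp _)
            · refine Integrable.of_bound (Measurable.aestronglyMeasurable (by fun_prop))
                (|1 + M| * B ^ (2 + δ')) (.of_forall fun ω => ?_)
              rw [norm_mul, mul_one]
              exact mul_le_mul_of_nonneg_left (hKp _ hp _) (norm_nonneg _)
            · have hadd := condExp_add (integrable_const (1 : ℝ)) hint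
                (MeasurableSpace.comap (X 0) inferInstance)
              rw [condExp_const hX0.comap_le] at hadd
              filter_upwards [hM, hadd] with ω hω hω'
              by_cases hw : |(X 0 ω - x₀) / h n| < τ
              · rw [abs_div, abs_of_pos (hhpos n), div_lt_iff₀ (hhpos n)] at hw
                have h4 : (μ[fun ω => 1 + |e 0 ω| ^ (2 + δ) |
                    MeasurableSpace.comap (X 0) inferInstance]) ω ≤ 1 + M := by
                  refine hω'.trans_le ?_
                  have := hω (by linarith)
                  simpa using this
                have h5 := mul_le_mul_of_nonneg_left h4
                  (Real.rpow_nonneg (hK0 ((X 0 ω - x₀) / h n)) (2 + δ'))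
                linarith
              · simp [hKsupp _ (not_lt.1 hw), hp.ne']
        _ = _ := integral_const_mul _ _
    simp only [habs]
    rw [integral_div]
    have hfac : √(n * h n) ^ (-δ') = n * h n / √(n * h n) ^ (2 + δ') := by
      rw [Real.rpow_add hs, Real.rpow_two, Real.sq_sqrt (mul_pos hn' (hhpos n)).le,
        Real.rpow_neg hs.le]
      have := hhpos n
      field_simp
    calc _ ≤ n * (((1 + M) * ∫ ω, K ((X 0 ω - x₀) / h n) ^ (2 + δ') * 1 ∂μ) /
          √(n * h n) ^ (2 + δ')) := by gcongr
      _ = _ := by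
          rw [hfac]
          have := (hhpos n).ne'
          field_simp

/-- The limiting variance of the noise term is nonnegative, as the limit of the variances of the
kernel weighted errors. Nonnegativity of `σsq` itself is known only almost everywhere. -/
lemma kernel_variance_nonneg {X e : Ω → ℝ} (hX : Measurable X) (hfm : Measurable f)
    (hf0 : ∀ x, 0 ≤ f x) (hfX : μ.map X = volume.withDensity fun x => ENNReal.ofReal (f x))
    (hfc : ContinuousAt f x₀) (hKm : Measurable K) (hKb : ∀ v, |K v| ≤ B)
    (hKsupp : ∀ v, τ ≤ |v| → K v = 0)
    (hhpos : ∀ n, 0 < h n) (hh0 : Tendsto h atTop (𝓝 0)) (hσm : Measurable σsq)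
    (hevar : μ[fun ω => e ω ^ 2 | MeasurableSpace.comap X inferInstance]
      =ᵐ[μ] fun ω => σsq (X ω))
    (hσc : ContinuousAt σsq x₀) : 0 ≤ (∫ v, K v ^ 2) * (σsq x₀ * f x₀) := by
  have h1 := tendsto_inv_mul_integral_kernel (W := fun v => K v ^ 2) (B := B ^ 2) (τ := τ)
    hX hfm hf0 hfX hfc (by fun_prop)
    (fun v => by rw [abs_pow]; exact pow_le_pow_left₀ (abs_nonneg _) (hKb v) 2)
    (fun v hv => by simp [hKsupp v hv]) hσm hσc hhpos hh0
  have h2 : 0 ≤ᵐ[μ] μ[fun ω => e ω ^ 2 | MeasurableSpace.comap X inferInstance] :=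
    condExp_nonneg (.of_forall fun ω => sq_nonneg _)
  refine ge_of_tendsto' h1 fun n =>
    mul_nonneg (inv_nonneg.2 (hhpos n).le) (integral_nonneg_of_ae ?_)
  filter_upwards [h2, hevar] with ω hω hω'
  rw [hω'] at hω
  exact mul_nonneg (sq_nonneg _) hω

end Noise

/-! ### The asymptotic normality of the estimator -/

/-- The untrimmed Nadaraya-Watson ratio, centered and scaled, as a quotient of kernel sums: the
noise term and the bias term over the kernel density estimate. -/
lemma sqrt_mul_ratio_sub {n : ℕ} (K g : ℝ → ℝ) {h : ℝ} (x₀ : ℝ) (x e : Fin n → ℝ) (hn : 0 < n)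
    (hh : 0 < h) (hD : ∑ i, K ((x i - x₀) / h) / (n * h) ≠ 0) :
    √(n * h) * ((∑ i, scaledKernel K h (x i - x₀) * (g (x i) + e i)) /
        (∑ i, scaledKernel K h (x i - x₀)) - g x₀) =
      (∑ i, K ((x i - x₀) / h) * e i / √(n * h) +
        ∑ i, K ((x i - x₀) / h) * (g (x i) - g x₀) / √(n * h)) /
        ∑ i, K ((x i - x₀) / h) / (n * h) := by
  have hnh : 0 < (n : ℝ) * h := by positivity
  have hs : 0 < √(n * h) := Real.sqrt_pos.2 hnh
  have hs2 : √(n * h) ^ 2 = n * h := Real.sq_sqrt hnh.le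
  have hnum : ∑ i, scaledKernel K h (x i - x₀) * (g (x i) + e i) =
      h⁻¹ * (∑ i, K ((x i - x₀) / h) * e i + ∑ i, K ((x i - x₀) / h) * (g (x i) - g x₀) +
        g x₀ * ∑ i, K ((x i - x₀) / h)) := by
    rw [Finset.mul_sum, ← Finset.sum_add_distrib, ← Finset.sum_add_distrib, Finset.mul_sum]
    exact Finset.sum_congr rfl fun i _ => by rw [scaledKernel]; ring
  have hden : ∑ i, scaledKernel K h (x i - x₀) = h⁻¹ * ∑ i, K ((x i - x₀) / h) := by
    rw [Finset.mul_sum]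
    rfl
  rw [hnum, hden]
  rw [← Finset.sum_div] at hD ⊢
  rw [← Finset.sum_div, ← Finset.sum_div]
  have hA : ∑ i, K ((x i - x₀) / h) ≠ 0 := fun h0 => hD (by rw [h0, zero_div])
  generalize √(n * h) = s at hs hs2 ⊢
  rw [← hs2]
  generalize ∑ i, K ((x i - x₀) / h) = A at hA ⊢
  generalize ∑ i, K ((x i - x₀) / h) * e i = E
  generalize ∑ i, K ((x i - x₀) / h) * (g (x i) - g x₀) = G
  field_simp
  ring

lemma floor_le_card_of_lt {n : ℕ} (hn : 0 < n) {α : ℝ} (s : Set ℝ) (x : Fin n → ℝ)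
    [DecidablePred (· ∈ s)]
    (hlt : α < ∑ i, s.indicator (fun _ => (1 : ℝ)) (x i) / n) :
    ⌊(n : ℝ) * α⌋₊ ≤ (Finset.univ.filter fun k => x k ∈ s).card := by
  have hn' : (0 : ℝ) < n := Nat.cast_pos.2 hn
  have hcard : ∑ i, s.indicator (fun _ => (1 : ℝ)) (x i) =
      ((Finset.univ.filter fun k => x k ∈ s).card : ℝ) := by
    simp [Set.indicator_apply]
  rw [← Finset.sum_div, hcard, lt_div_iff₀ hn', mul_comm] at hlt
  exact Nat.floor_le_of_le hlt.le

/-- The bias correction in the centering vanishes at the rate of the limit theorem. -/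
lemma tendsto_sqrt_mul_biasTerm (P : Measure ℝ) {f g K : ℝ → ℝ} {α x₀ : ℝ} {h : ℕ → ℝ}
    (hα0 : 0 ≤ α) (hα : α < 1 / 2) (hl : α < cdf P x₀) (hr : cdf P x₀ < 1 - α)
    (hF : HasDerivAt (cdf P) (f x₀) x₀) (hf : DifferentiableAt ℝ f x₀)
    (hhsq : Tendsto (fun n : ℕ => √(n * h n) * h n ^ 2) atTop (𝓝 0)) :
    Tendsto (fun n : ℕ => √(n * h n) * biasTerm P f g K (h n) α n x₀) atTop (𝓝 0) := by
  have h1 := (tendsto_avgDensity P f x₀ hα0 hα hl hr).isBigO_one ℝ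
  have h2 := avgDensityDeriv_isBigO P f x₀ hα0 hα hl hr hF hf
  have h3 := (h1.const_mul_left (deriv (deriv g) x₀ / 2)).add (h2.const_mul_left (deriv g x₀))
  have h4 := ((isBigO_refl (fun n : ℕ => √(n * h n) * h n ^ 2) atTop).mul h3).const_mul_left
    (∫ v, v ^ 2 * K v)
  refine (h4.trans_tendsto (by simpa using hhsq)).congr fun n => ?_
  rw [biasTerm]
  ring

end TrimmedNW

theorem theorem1
    {Ω : Type*} [MeasurableSpace Ω] (μ : Measure Ω) [IsProbabilityMeasure μ]
    -- the random sample `(X i, Y i)`, with `(X i, e i)` i.i.d. and `Y i = g (X i) + e i`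
    (X Y e : ℕ → Ω → ℝ) (g : ℝ → ℝ)
    (hX : ∀ i, Measurable (X i)) (he : ∀ i, Measurable (e i)) (hg : Measurable g)
    (hindep : iIndepFun (fun i ω => (X i ω, e i ω)) μ)
    (hident : ∀ i, IdentDistrib (fun ω => (X i ω, e i ω)) (fun ω => (X 0 ω, e 0 ω)) μ μ)
    (hY : ∀ i ω, Y i ω = g (X i ω) + e i ω)
    (α x₀ : ℝ) (hα0 : 0 ≤ α) (hα : α < 1 / 2)
    -- (A1): `g` is twice continuously differentiable on a compact set around `x₀`
    (C : Set ℝ) (hC : IsCompact C) (hx₀C : x₀ ∈ interior C) (hgC : ContDiffOn ℝ 2 g C)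
    -- (A2): `X` has a bounded density `f`, differentiable at `x₀`
    (f : ℝ → ℝ) (hfm : Measurable f) (hf0 : ∀ x, 0 ≤ f x) (hfb : ∃ B, ∀ x, f x ≤ B)
    (hfX : μ.map (X 0) = volume.withDensity (fun x => ENNReal.ofReal (f x)))
    (hfd : DifferentiableAt ℝ f x₀)
    -- `x₀` lies in the region that is not trimmed away
    (hfpos : 0 < f x₀) (hFl : α < cdf (μ.map (X 0)) x₀) (hFr : cdf (μ.map (X 0)) x₀ < 1 - α)
    -- (A3), (A4): the kernel and the bandwidths
    (K : ℝ → ℝ) (τ : ℝ) (h : ℕ → ℝ)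
    (hKm : Measurable K) (hK0 : ∀ u, 0 ≤ K u) (hKb : ∃ B, ∀ u, K u ≤ B)
    (hKsupp : Function.support K ⊆ Set.Ioo (-τ) τ)
    (hK1 : ∫ u, K u = 1) (hKmean : ∫ u, u * K u = 0)
    (hKh : (fun n => (h n)⁻¹ * K ((h n)⁻¹)) =O[atTop] (fun _ => (1 : ℝ)))
    (hhpos : ∀ n, 0 < h n) (hh : h =O[atTop] (fun n : ℕ => (n : ℝ) ^ (-(1 / 3 : ℝ))))
    (hnh : Tendsto (fun n : ℕ => (n : ℝ) * h n) atTop atTop)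
    -- (A5): symmetric error density, `E(e | X) = 0`, `E(e² | X = x) = σ²(x)`
    (hesym : ∃ fe : ℝ → ℝ, Measurable fe ∧ (∀ x, 0 ≤ fe x) ∧ (∀ x, fe (-x) = fe x) ∧
      μ.map (e 0) = volume.withDensity (fun x => ENNReal.ofReal (fe x)))
    (hemean : μ[e 0 | MeasurableSpace.comap (X 0) inferInstance] =ᵐ[μ] 0)
    (σsq : ℝ → ℝ) (hσm : Measurable σsq)
    (hevar : μ[fun ω => e 0 ω ^ 2 | MeasurableSpace.comap (X 0) inferInstance]
      =ᵐ[μ] fun ω => σsq (X 0 ω))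
    (hσc : ContinuousAt σsq x₀)
    -- (A6): a finite moment of order `2 + δ`, conditionally bounded near `x₀`
    (hmoment : ∃ δ : ℝ, 0 < δ ∧ Integrable (fun ω => |e 0 ω| ^ (2 + δ)) μ ∧
      ∃ M r : ℝ, 0 < r ∧ ∀ᵐ ω ∂μ, |X 0 ω - x₀| < r →
        (μ[fun ω => |e 0 ω| ^ (2 + δ) | MeasurableSpace.comap (X 0) inferInstance]) ω ≤ M) :
    ∃ t : ℝ, 0 < t ∧
      Tendsto (fun n => TrimmedNW.avgDensity (μ.map (X 0)) f α n x₀) atTop (𝓝 t) ∧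
      TendstoInDistribution
        (fun (n : ℕ) ω => √((n : ℝ) * h n) *
          (TrimmedNW.estimator K (h n) α x₀ (fun i : Fin n => X i ω) (fun i : Fin n => Y i ω)
            - g x₀ - TrimmedNW.biasTerm (μ.map (X 0)) f g K (h n) α n x₀))
        atTop (id : ℝ → ℝ) (fun _ => μ)
        (gaussianReal 0 (TrimmedNW.asymptoticVariance K α (σsq x₀) t).toNNReal) := by
  obtain ⟨B, hKb⟩ := hKb
  obtain ⟨δ, hδ, hint, M, r, hr, hM⟩ := hmoment
  have hX0 := hX 0
  have hτK : ∀ v, τ ≤ |v| → K v = 0 := by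
    intro v hv
    by_contra hne
    exact absurd (abs_lt.2 (hKsupp hne)) (not_lt.2 hv)
  have hKb' : ∀ v, |K v| ≤ B := fun v => by rw [abs_of_nonneg (hK0 v)]; exact hKb v
  have hh0 := TrimmedNW.tendsto_zero_of_isBigO_rpow hh
  have hhsq := TrimmedNW.tendsto_sqrt_mul_sq hh
  have hfc := hfd.continuousAt
  have hiX : iIndepFun X μ := hindep.comp (fun _ => Prod.fst) fun _ => measurable_fst
  have hidX : ∀ i, IdentDistrib (X i) (X 0) μ μ := fun i => (hident i).comp measurable_fst
  set P := μ.map (X 0) with hP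
  have : IsProbabilityMeasure P := Measure.isProbabilityMeasure_map hX0.aemeasurable
  have hF : HasDerivAt (cdf P) (f x₀) x₀ := TrimmedNW.hasDerivAt_cdf hfm hf0 hfX hfc
  have hα' : 0 < 1 - 2 * α := by linarith
  refine ⟨(1 - 2 * α)⁻¹ * f x₀, by positivity,
    TrimmedNW.tendsto_avgDensity P f x₀ hα0 hα hFl hFr, ?_⟩
  set V := TrimmedNW.asymptoticVariance K α (σsq x₀) ((1 - 2 * α)⁻¹ * f x₀) with hVdef
  have hV : (∫ v, K v ^ 2) * (σsq x₀ * f x₀) = f x₀ ^ 2 * V := by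
    rw [hVdef, TrimmedNW.asymptoticVariance]
    field_simp
  have hv := TrimmedNW.kernel_variance_nonneg hX0 hfm hf0 hfX hfc hKm hKb' hτK hhpos hh0 hσm
    hevar hσc
  -- the limit of the noise term is `f x₀` times the limit of the statistic
  have hG : HasLaw (fun z : ℝ => f x₀ * z)
      (gaussianReal 0 ((∫ v, K v ^ 2) * (σsq x₀ * f x₀)).toNNReal) (gaussianReal 0 V.toNNReal) := by
    have h1 := gaussianReal_const_mul
      (HasLaw.id (μ := gaussianReal 0 V.toNNReal)) (f x₀)
    have h2 : (.mk (f x₀ ^ 2) (sq_nonneg _) : NNReal) * V.toNNReal =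
        ((∫ v, K v ^ 2) * (σsq x₀ * f x₀)).toNNReal := by
      rw [hV, Real.toNNReal_mul (sq_nonneg _), Real.toNNReal_of_nonneg (sq_nonneg _)]
    rw [mul_zero] at h1
    rw [← h2]
    exact h1
  have hS := TrimmedNW.tendstoInDistribution_noise hX he hindep hident hfm hf0 hfX hfc hKm hK0 hKb
    hτK hhpos hh0 hnh hemean hσm hevar hσc hδ hint hr hM hv hG
  have hB := TrimmedNW.tendstoInMeasure_bias hX hiX hidX hfm hf0 hfX hfd hg hx₀C hgC hKm hK0 hKb'
    hτK hK1 hKmean hhpos hh0 hhsq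
  have hD := TrimmedNW.tendstoInMeasure_denominator hX hiX hidX hfm hf0 hfX hfc hKm hKb' hτK hK1
    hhpos hh0 hnh
  have hbias := TrimmedNW.tendsto_sqrt_mul_biasTerm P (g := g) (K := K) hα0 hα hFl hFr hF hfd hhsq
  set S : ℕ → Ω → ℝ := fun n ω => ∑ i : Fin n, K ((X i ω - x₀) / h n) * e i ω / √(n * h n)
  set A : ℕ → Ω → ℝ := fun n ω =>
    ∑ i : Fin n, K ((X i ω - x₀) / h n) * (g (X i ω) - g x₀) / √(n * h n)
  set D : ℕ → Ω → ℝ := fun n ω => ∑ i : Fin n, K ((X i ω - x₀) / h n) / (n * h n)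
  have hAm (n : ℕ) : Measurable (A n) := by fun_prop
  have hDm (n : ℕ) : Measurable (D n) := by fun_prop
  have hSA := hS.add_of_tendstoInMeasure_const hB fun n => (hAm n).aemeasurable
  -- division is continuous once the denominator is kept away from zero
  have hW := hSA.continuous_comp_prodMk_of_tendstoInMeasure_const
    (g := fun p : ℝ × ℝ => p.1 / max p.2 (f x₀ / 2))
    (Continuous.div (by fun_prop) (by fun_prop) fun p =>
      (lt_max_of_lt_right (half_pos hfpos)).ne') hD fun n => (hDm n).aemeasurable
  have hlim : (fun z : ℝ => (f x₀ * z + 0) / max (f x₀) (f x₀ / 2)) = id := by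
    ext z
    rw [max_eq_left (by linarith), add_zero, mul_div_cancel_left₀ _ hfpos.ne', id]
  simp only [hlim, Pi.add_apply] at hW
  refine tendstoInDistribution_of_tendstoInMeasure_sub _ _ hW ?_ fun n => ?_
  swap
  · have hYm (i : ℕ) : Measurable (Y i) := by
      have h1 : Y i = fun ω => g (X i ω) + e i ω := funext (hY i)
      rw [h1]
      have := hX i
      have := he i
      fun_prop
    exact ((((TrimmedNW.measurable_estimator (fun i : Fin n => hX i) (fun i : Fin n => hYm i) hKm
      (h n) α x₀).sub_const _).sub_const _).const_mul _).aemeasurable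
  -- a window around `x₀` with more than a share `α` of the mass on either side
  obtain ⟨η, hη, hball⟩ := Metric.eventually_nhds_iff.1
    ((hF.continuousAt.eventually_const_lt hFl).and (hF.continuousAt.eventually_lt_const hFr))
  have hηd : ∀ s, |s| = η / 2 → dist (x₀ + s) x₀ < η := fun s hs => by
    rw [Real.dist_eq, add_sub_cancel_left, hs]
    linarith
  have ha : α < P.real (Set.Iic (x₀ - η / 2)) := by
    rw [← cdf_eq_real, sub_eq_add_neg]
    exact (hball (hηd _ (by rw [abs_neg, abs_of_pos (half_pos hη)]))).1
  have hb : α < P.real (Set.Ioi (x₀ + η / 2)) := by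
    rw [← Set.compl_Iic, probReal_compl_eq_one_sub measurableSet_Iic, ← cdf_eq_real]
    linarith [(hball (hηd _ (abs_of_pos (half_pos hη)))).2]
  have hL := TrimmedNW.tendstoInMeasure_empirical hX hiX hidX (measurableSet_Iic (a := x₀ - η / 2))
  have hR := TrimmedNW.tendstoInMeasure_empirical hX hiX hidX (measurableSet_Ioi (a := x₀ + η / 2))
  rw [tendstoInMeasure_iff_norm] at hL hR hD ⊢
  intro ε hε
  have hbad := ((hL _ (sub_pos.2 ha)).add (hR _ (sub_pos.2 hb))).add (hD _ (half_pos hfpos))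
  rw [add_zero, add_zero] at hbad
  have hτ : Tendsto (fun n => h n * τ) atTop (𝓝 0) := by simpa using hh0.mul_const τ
  refine tendsto_of_tendsto_of_tendsto_of_le_of_le' tendsto_const_nhds hbad
    (.of_forall fun _ => zero_le) ?_
  filter_upwards [eventually_gt_atTop 0, hτ.eventually_lt_const (half_pos hη),
    hbias.norm.eventually_lt_const (by rwa [norm_zero])] with n hn hnτ hnb
  refine (measure_mono ?_).trans ((measure_union_le _ _).trans
    (add_le_add_left (measure_union_le _ _) _))
  intro ω hω
  contrapose! hω
  simp only [Set.mem_union, Set.mem_ofPred_eq, not_or, not_le, Real.norm_eq_abs, abs_lt] at hω ⊢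
  obtain ⟨⟨⟨hL1, -⟩, hR1, -⟩, hD1, -⟩ := hω
  have hDpos : f x₀ / 2 < D n ω := by linarith
  have hest : √(n * h n) * (TrimmedNW.estimator K (h n) α x₀ (fun i : Fin n => X i ω)
      (fun i : Fin n => Y i ω) - g x₀) = (S n ω + A n ω) / D n ω := by
    rw [TrimmedNW.estimator_eq_of_card K (h n) α x₀ (x₀ - η / 2) (x₀ + η / 2) _ _ ?_
      (TrimmedNW.floor_le_card_of_lt hn (Set.Iic (x₀ - η / 2)) (fun i : Fin n => X i ω)
        (by linarith))
      (TrimmedNW.floor_le_card_of_lt hn (Set.Ioi (x₀ + η / 2)) (fun i : Fin n => X i ω)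
        (by linarith))]
    · simp only [hY]
      exact TrimmedNW.sqrt_mul_ratio_sub K g x₀ (fun i : Fin n => X i ω) (fun i => e i ω) hn
        (hhpos n) (by have := half_pos hfpos; exact (this.trans hDpos).ne')
    · intro u hu
      have h1 : |(u - x₀) / h n| < τ := not_le.1 fun hle => hu (hτK _ hle)
      rw [abs_div, abs_of_pos (hhpos n), div_lt_iff₀ (hhpos n), mul_comm τ] at h1
      have h2 := abs_lt.1 (h1.trans hnτ)
      constructor <;> linarith [h2.1, h2.2]
  have hdiff : √(n * h n) * (TrimmedNW.estimator K (h n) α x₀ (fun i : Fin n => X i ω)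
      (fun i : Fin n => Y i ω) - g x₀ - TrimmedNW.biasTerm P f g K (h n) α n x₀) -
      (S n ω + A n ω) / max (D n ω) (f x₀ / 2) =
      -(√(n * h n) * TrimmedNW.biasTerm P f g K (h n) α n x₀) := by
    rw [mul_sub, hest, max_eq_left hDpos.le]
    ring
  simp only [Pi.sub_apply, Pi.zero_apply, sub_zero]
  rw [hdiff]
  rw [Real.norm_eq_abs, ← abs_neg] at hnb
  exact abs_lt.1 hnb
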